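/- Let $l\in[-\tfrac12,\tfrac12)$ and let $q$ be real-valued with $x\,q(x)\in L^1(0,1)$ if $l>-\frac12$, and $x(1-\log x)q(x)\in L^1(0,1)$ if $l=-\frac12$. Let $\phi(z,x),\theta(z,x)$ be real entire (in $z$) solutions of $$-y''+\Big(\frac{l(l+1)}{x^2}+q(x)\Big)y=zy,\qquad x\in(0,1],$$ such that, for $x$ near $0$, $\phi(z,x)=x^{l+1}\tilde\phi(z,x)$, and $\theta(z,x)=\frac{x^{-l}}{2l+1}\tilde\theta(z,x)$ if $l>-\frac12$, $\theta(z,x)=-x^{1/2}\log(x)\,\tilde\theta(z,x)$ if $l=-\frac12$, where $\tilde\phi(z,\cdot),\tilde\theta(z,\cdot)$ are absolutely continuous up to $x=0$ ($W^{1,1}$ near $0$) and equal $1$ at $x=0$. Put $W_x(f,g)=f(x)g'(x)-f'(x)g(x)$. Fix $\lambda_0\in\mathbb R$ and assume $\lim_{x\to0}W_x(\theta(\lambda_0),\theta(z))=0$ for all $z\in\mathbb C$. For $\beta\in[0,\pi)$ let $H$ be the operator $-\frac{d^2}{dx^2}+\frac{l(l+1)}{x^2}+q$ in $L^2(0,1)$,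 on its maximal domain subject to $$\lim_{x\to0}W_x(f,\theta(\lambda_0))=0,\qquad \cos(\beta)f(1)-\sin(\beta)f'(1)=0,$$ and assume $H\ge\varepsilon$ for some $\varepsilon>0$. Then $\theta_0(x):=\theta(0,x)$ is positive on $(0,1]$, $1/\theta_0^2\in L^1(0,1)$, and with $$\xi=\xi(x)=\int_0^x\frac{dt}{\theta_0(t)^2},\qquad a=\xi(1),\qquad r(\xi)=\theta_0(x)^4,$$ $\xi$ is a bijection of $[0,1]$ onto $[0,a]$, $r>0$ on $(0,a)$, and $r\in L^1(0,a)$. The map $U:v(x)\mapsto u(\xi)=v(x)/\theta_0(x)$ is unitary from $L^2(0,1)$ onto $L^2_r(0,a)$. Let $\tilde\beta\in[0,\pi)$ be given by $\cot\tilde\beta=\theta_0(1)\big(\theta_0(1)\cot\beta-\theta_0'(1)\big)$ (with $\tilde\beta=0$ if and only if $\beta=0$), and let $L$ be the Krein string operator $-\frac1{r(\xi)}\frac{d^2}{d\xi^2}$ in $L^2_r(0,a)$, on its maximal domain subject to $y'(0)=0$ and $\cos(\tilde\beta)y(a)-\sin(\tilde\beta)y'(a)=0$. Then: 1. $H=U^{-1}LU$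 (including equality of domains). 2. The fundamental solutions $c(z,\xi),s(z,\xi)$ of $-y''=z\,r(\xi)y$ on $[0,a]$ with $c(z,0)=s'(z,0)=1$, $c'(z,0)=s(z,0)=0$ exist and satisfy, for all $z\in\mathbb C$, $$c(z,\xi)=(U\theta(z))(\xi),\qquad s(z,\xi)=(U\phi(z))(\xi),\qquad \xi\in(0,a].$$ 3. For every $z\in\mathbb C\setminus\mathbb R$ there is exactly one $\tilde m(z)\in\mathbb C$ such that $\psi=\phi(z,\cdot)-\tilde m(z)\theta(z,\cdot)$ satisfies $\cos(\beta)\psi(1)-\sin(\beta)\psi'(1)=0$, and exactly one $M(z)\in\mathbb C$ such that $y=s(z,\cdot)-M(z)c(z,\cdot)$ satisfies $\cos(\tilde\beta)y(a)-\sin(\tilde\beta)y'(a)=0$; moreover $\tilde m(z)=M(z)$. -/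

import Mathlib

open MeasureTheory Set Filter Topology

noncomputable section

namespace PerturbedBessel

/-! ### Absolutely continuous functions and second order equations -/

/-- `F` is locally absolutely continuous on the interval `I`, with a.e. derivative `w`:
`w` is integrable on every compact interval `[x, y] ⊆ I` and `F y - F x = ∫ t in x..y, w t`. -/
def IsACWithDeriv (I : Set ℝ) (F w : ℝ → ℂ) : Prop :=
  ∀ x ∈ I, ∀ y ∈ I, x ≤ y →
    IntervalIntegrable w volume x y ∧ F y - F x = ∫ t in x..y, w t

theorem IsACWithDeriv.add {I : Set ℝ} {F G u v : ℝ → ℂ} (hF : IsACWithDeriv I F u)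
    (hG : IsACWithDeriv I G v) : IsACWithDeriv I (F + G) (u + v) := by
  intro x hx y hy hxy
  obtain ⟨h1, h2⟩ := hF x hx y hy hxy
  obtain ⟨h3, h4⟩ := hG x hx y hy hxy
  refine ⟨h1.add h3, ?_⟩
  simp only [Pi.add_apply]
  rw [intervalIntegral.integral_add h1 h3, ← h2, ← h4]
  ring

theorem IsACWithDeriv.smul {I : Set ℝ} {F u : ℝ → ℂ} (c : ℂ) (hF : IsACWithDeriv I F u) :
    IsACWithDeriv I (c • F) (c • u) := by
  intro x hx y hy hxy
  obtain ⟨h1, h2⟩ := hF x hx y hy hxy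
  refine ⟨h1.smul c, ?_⟩
  simp only [Pi.smul_apply]
  rw [intervalIntegral.integral_smul, ← h2, smul_sub]

theorem IsACWithDeriv.congr_left {I : Set ℝ} {F G u : ℝ → ℂ} (hF : IsACWithDeriv I F u)
    (h : EqOn F G I) : IsACWithDeriv I G u := by
  intro x hx y hy hxy
  rw [← h hx, ← h hy]
  exact hF x hx y hy hxy

/-- A function with vanishing increments has a.e. derivative `0`. -/
theorem IsACWithDeriv.ae_eq_zero {I : Set ℝ} {α β : ℝ} {F u : ℝ → ℂ} (hI : Ioo α β ⊆ I)
    (hF : IsACWithDeriv I F u) (h0 : ∀ x ∈ I, F x = 0) :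
    ∀ᵐ x, x ∈ Ioo α β → u x = 0 := by
  have key : ∀ p q : ℚ, ∀ᵐ x : ℝ, (p : ℝ) ∈ I → (q : ℝ) ∈ I → Icc (p : ℝ) q ⊆ I →
      x ∈ Ioo (p : ℝ) q → u x = 0 := by
    intro p q
    by_cases hh : (p : ℝ) ∈ I ∧ (q : ℝ) ∈ I ∧ Icc (p : ℝ) q ⊆ I ∧ (p : ℝ) ≤ q
    · obtain ⟨hp, hq, hpq, hle⟩ := hh
      have hint := (hF p hp q hq hle).1
      filter_upwards [hint.ae_hasDerivAt_integral] with x hx _ _ _ hxm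
      have hx' := hx (by rw [uIcc_of_le hle]; exact Ioo_subset_Icc_self hxm) p
        (by rw [uIcc_of_le hle]; exact left_mem_Icc.2 hle)
      have hz : (fun t => ∫ s in (p : ℝ)..t, u s) =ᶠ[𝓝 x] fun _ => (0 : ℂ) := by
        filter_upwards [Ioo_mem_nhds hxm.1 hxm.2] with t ht
        have := (hF p hp t (hpq (Ioo_subset_Icc_self ht)) ht.1.le).2
        rw [← this, h0 _ hp, h0 _ (hpq (Ioo_subset_Icc_self ht)), sub_zero]
      exact hx'.unique ((hasDerivAt_const x (0 : ℂ)).congr_of_eventuallyEq hz)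
    · refine Eventually.of_forall fun x hp hq hpq hxm => ?_
      exact absurd ⟨hp, hq, hpq, (hxm.1.trans hxm.2).le⟩ hh
  filter_upwards [ae_all_iff.2 fun p => ae_all_iff.2 (key p)] with x hx hxm
  obtain ⟨p, hp1, hp2⟩ := exists_rat_btwn hxm.1
  obtain ⟨q, hq1, hq2⟩ := exists_rat_btwn hxm.2
  have hsub : Icc (p : ℝ) q ⊆ I := fun t ht => hI ⟨hp1.trans_le ht.1, ht.2.trans_lt hq2⟩
  have hle : (p : ℝ) ≤ q := (hp2.trans hq1).le
  exact hx p q (hsub (left_mem_Icc.2 hle)) (hsub (right_mem_Icc.2 hle)) hsub ⟨hp2, hq1⟩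

/-- `g` is differentiable on the interval `I` (one-sidedly at endpoints belonging to `I`), its
derivative is locally absolutely continuous on `I`, and `g'' = w` almost everywhere on `I`. -/
def HasSecondDeriv (I : Set ℝ) (g w : ℝ → ℂ) : Prop :=
  DifferentiableOn ℝ g I ∧ IsACWithDeriv I (derivWithin g I) w

theorem HasSecondDeriv.add {I : Set ℝ} {F G u v : ℝ → ℂ} (hF : HasSecondDeriv I F u)
    (hG : HasSecondDeriv I G v) : HasSecondDeriv I (F + G) (u + v) := by
  refine ⟨hF.1.add hG.1, (hF.2.add hG.2).congr_left fun x hx => ?_⟩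
  exact (derivWithin_add (hF.1 x hx) (hG.1 x hx)).symm

theorem HasSecondDeriv.smul {I : Set ℝ} {F u : ℝ → ℂ} (c : ℂ) (hF : HasSecondDeriv I F u) :
    HasSecondDeriv I (c • F) (c • u) := by
  refine ⟨hF.1.const_smul c, (hF.2.smul c).congr_left fun x hx => ?_⟩
  exact (derivWithin_const_smul c (hF.1 x hx)).symm

theorem HasSecondDeriv.zero (I : Set ℝ) : HasSecondDeriv I 0 0 := by
  refine ⟨differentiableOn_const 0, fun x _ y _ _ => ?_⟩
  have h : ∀ t, derivWithin (0 : ℝ → ℂ) I t = 0 := fun t => by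
    exact congrFun (derivWithin_const (s := I) (c := (0 : ℂ))) t
  rw [h, h]
  exact ⟨intervalIntegrable_const, by simp⟩

/-- If `g = 0` on `I` then `g'' = 0` a.e. -/
theorem HasSecondDeriv.ae_eq_zero {I : Set ℝ} {α β : ℝ} {g u : ℝ → ℂ} (hI : Ioo α β ⊆ I)
    (hg : HasSecondDeriv I g u) (h0 : ∀ x ∈ I, g x = 0) :
    ∀ᵐ x, x ∈ Ioo α β → u x = 0 := by
  refine hg.2.ae_eq_zero hI fun x hx => ?_
  rw [derivWithin_congr (fun y hy => h0 y hy) (h0 x hx)]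
  exact congrFun (derivWithin_const (s := I) (c := (0 : ℂ))) x

/-- The Wronskian `W_x(f, g) = f(x) g'(x) - f'(x) g(x)` for functions on `(0, 1]`. -/
def wronskian (f g : ℝ → ℂ) (x : ℝ) : ℂ :=
  f x * derivWithin g (Ioc 0 1) x - derivWithin f (Ioc 0 1) x * g x

/-! ### The perturbed Bessel operator -/

/-- The assumption on the potential: `x q(x) ∈ L¹(0,1)` if `l > -1/2`, and
`x (1 - log x) q(x) ∈ L¹(0,1)` if `l = -1/2`. -/
def IsAdmissiblePotential (l : ℝ) (q : ℝ → ℝ) : Prop :=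
  (-1 / 2 < l → IntegrableOn (fun x => x * q x) (Ioo 0 1)) ∧
  (l = -1 / 2 → IntegrableOn (fun x => x * (1 - Real.log x) * q x) (Ioo 0 1))

/-- The full potential `l(l+1)/x² + q(x)`. -/
def besselPotential (l : ℝ) (q : ℝ → ℝ) (x : ℝ) : ℝ := l * (l + 1) / x ^ 2 + q x

/-- `y` solves `-y'' + (l(l+1)/x² + q) y = z y` on `(0, 1]` (in the Carathéodory sense). -/
def IsBesselSolution (l : ℝ) (q : ℝ → ℝ) (z : ℂ) (y : ℝ → ℂ) : Prop :=
  HasSecondDeriv (Ioc 0 1) y (fun x => ((besselPotential l q x : ℂ) - z) * y x)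

/-- The leading behaviour of the non-principal solution at `0`: `x^(-l)/(2l+1)` if `l > -1/2` and
`-√x log x` if `l = -1/2`. -/
def singularFactor (l x : ℝ) : ℝ :=
  if l = -1 / 2 then -(Real.sqrt x * Real.log x) else x ^ (-l) / (2 * l + 1)

/-- `y = p · ỹ` near `0` with `ỹ` absolutely continuous up to `0` (that is, `W^{1,1}`) and
`ỹ(0) = 1`. -/
def HasLeadingFactor (p : ℝ → ℝ) (y : ℝ → ℂ) : Prop :=
  ∃ c : ℝ, 0 < c ∧ c < 1 ∧ ∃ t w : ℝ → ℂ,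
    IsACWithDeriv (Icc 0 c) t w ∧ t 0 = 1 ∧ ∀ x ∈ Ioc 0 c, y x = (p x : ℂ) * t x

/-- `φ(z,x)`, `θ(z,x)` is a real entire system of solutions of the perturbed Bessel equation with
the normalisation `φ = x^(l+1) φ̃`, `θ = x^(-l)/(2l+1) θ̃` (resp. `θ = -√x log x θ̃` if
`l = -1/2`), `φ̃, θ̃ ∈ W^{1,1}` near `0`, `φ̃(0) = θ̃(0) = 1`. -/
structure IsBesselSystem (l : ℝ) (q : ℝ → ℝ) (φ θ : ℂ → ℝ → ℂ) : Prop where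
  solves_phi : ∀ z, IsBesselSolution l q z (φ z)
  solves_theta : ∀ z, IsBesselSolution l q z (θ z)
  entire_phi : ∀ x ∈ Ioc (0 : ℝ) 1, Differentiable ℂ (fun z => φ z x)
  entire_theta : ∀ x ∈ Ioc (0 : ℝ) 1, Differentiable ℂ (fun z => θ z x)
  real_phi : ∀ t : ℝ, ∀ x ∈ Ioc (0 : ℝ) 1, (φ t x).im = 0
  real_theta : ∀ t : ℝ, ∀ x ∈ Ioc (0 : ℝ) 1, (θ t x).im = 0
  leading_phi : ∀ z, HasLeadingFactor (fun x => x ^ (l + 1)) (φ z)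
  leading_theta : ∀ z, HasLeadingFactor (singularFactor l) (θ z)

/-- The boundary condition `cos β f(1) - sin β f'(1) = 0`. -/
def BCOne (β : ℝ) (f : ℝ → ℂ) : Prop :=
  (Real.cos β : ℂ) * f 1 - (Real.sin β : ℂ) * derivWithin f (Ioc 0 1) 1 = 0

/-- The Hilbert space `L²(0,1)`. -/
abbrev L2 := Lp ℂ 2 (volume.restrict (Ioo (0 : ℝ) 1))

/-- The graph of the operator `H = -d²/dx² + l(l+1)/x² + q` in `L²(0,1)`: the pairs `(f, h)` such
that `f` (has a representative which) is differentiable with `f' ∈ AC_loc(0,1]`, `τ f = h`,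
`lim_{x→0} W_x(f, θ) = 0` and `cos β f(1) - sin β f'(1) = 0`. Here `θ` is the function inducing
the boundary condition at `0`. -/
def besselGraph (l : ℝ) (q : ℝ → ℝ) (θ : ℝ → ℂ) (β : ℝ) : Submodule ℂ (L2 × L2) where
  carrier := {p | ∃ g k : ℝ → ℂ, (p.1 : ℝ → ℂ) =ᵐ[volume.restrict (Ioo (0 : ℝ) 1)] g ∧
    (p.2 : ℝ → ℂ) =ᵐ[volume.restrict (Ioo (0 : ℝ) 1)] k ∧
    HasSecondDeriv (Ioc 0 1) g (fun x => (besselPotential l q x : ℂ) * g x - k x) ∧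
    Tendsto (wronskian g θ) (𝓝[>] 0) (𝓝 0) ∧ BCOne β g}
  add_mem' := by
    rintro p p' ⟨g, k, h1, h2, h3, h4, h5⟩ ⟨g', k', h1', h2', h3', h4', h5'⟩
    have hd : ∀ x ∈ Ioc (0 : ℝ) 1, derivWithin (g + g') (Ioc 0 1) x =
        derivWithin g (Ioc 0 1) x + derivWithin g' (Ioc 0 1) x := fun x hx =>
      derivWithin_add (h3.1 x hx) (h3'.1 x hx)
    refine ⟨g + g', k + k', (Lp.coeFn_add p.1 p'.1).trans (h1.add h1'),
      (Lp.coeFn_add p.2 p'.2).trans (h2.add h2'), ?_, ?_, ?_⟩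
    · convert h3.add h3' using 1
      funext x
      simp only [Pi.add_apply]
      ring
    · have := h4.add h4'
      rw [add_zero] at this
      refine this.congr' ?_
      filter_upwards [Ioc_mem_nhdsGT (zero_lt_one' ℝ)] with x hx
      simp only [wronskian, Pi.add_apply, hd x hx]
      ring
    · unfold BCOne at *
      rw [hd 1 (right_mem_Ioc.2 zero_lt_one), Pi.add_apply]
      linear_combination h5 + h5'
  zero_mem' := by
    have hd : ∀ x, derivWithin (0 : ℝ → ℂ) (Ioc 0 1) x = 0 := fun x =>
      congrFun (derivWithin_const (s := Ioc (0 : ℝ) 1) (c := (0 : ℂ))) x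
    refine ⟨0, 0, Lp.coeFn_zero ℂ 2 _, Lp.coeFn_zero ℂ 2 _, ?_, ?_, ?_⟩
    · convert HasSecondDeriv.zero (Ioc (0 : ℝ) 1) using 1
      funext x
      simp
    · have : wronskian 0 θ = fun _ => 0 := by
        funext x
        simp [wronskian, hd]
      rw [this]
      exact tendsto_const_nhds
    · simp [BCOne, hd]
  smul_mem' := by
    rintro c p ⟨g, k, h1, h2, h3, h4, h5⟩
    have hd : ∀ x ∈ Ioc (0 : ℝ) 1, derivWithin (c • g) (Ioc 0 1) x =
        c * derivWithin g (Ioc 0 1) x := fun x hx => derivWithin_const_smul c (h3.1 x hx)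
    refine ⟨c • g, c • k, (Lp.coeFn_smul c p.1).trans (h1.const_smul c),
      (Lp.coeFn_smul c p.2).trans (h2.const_smul c), ?_, ?_, ?_⟩
    · convert h3.smul c using 1
      funext x
      simp only [Pi.smul_apply, smul_eq_mul]
      ring
    · have := h4.const_mul c
      rw [mul_zero] at this
      refine this.congr' ?_
      filter_upwards [Ioc_mem_nhdsGT (zero_lt_one' ℝ)] with x hx
      simp only [wronskian, Pi.smul_apply, smul_eq_mul, hd x hx]
      ring
    · unfold BCOne at *
      rw [hd 1 (right_mem_Ioc.2 zero_lt_one), Pi.smul_apply, smul_eq_mul]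
      linear_combination c * h5

/-- The operator `H` in `L²(0,1)`; its graph is `besselGraph`, see `besselOp_graph`. -/
def besselOp (l : ℝ) (q : ℝ → ℝ) (θ : ℝ → ℂ) (β : ℝ) : L2 →ₗ.[ℂ] L2 :=
  (besselGraph l q θ β).toLinearPMap

theorem besselOp_graph (l : ℝ) (q : ℝ → ℝ) (θ : ℝ → ℂ) (β : ℝ) :
    (besselOp l q θ β).graph = besselGraph l q θ β := by
  refine Submodule.toLinearPMap_graph_eq _ ?_
  rintro ⟨f, h⟩ ⟨g, k, h1, h2, h3, -, -⟩ hf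
  simp only at hf h1 h2
  have hg0 : g =ᵐ[volume.restrict (Ioc (0 : ℝ) 1)] 0 := by
    rw [← restrict_Ioo_eq_restrict_Ioc]
    rw [hf] at h1
    exact h1.symm.trans (Lp.coeFn_zero ℂ 2 _)
  have hg : ∀ x ∈ Ioc (0 : ℝ) 1, g x = 0 := fun x hx =>
    Measure.eqOn_Ioc_of_ae_eq volume hg0 h3.1.continuousOn continuousOn_const hx
  have hk := h3.ae_eq_zero Ioo_subset_Ioc_self hg
  refine (Lp.eq_zero_iff_ae_eq_zero).2 (h2.trans ?_)
  filter_upwards [ae_restrict_of_ae hk, ae_restrict_mem measurableSet_Ioo] with x hx hxm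
  have := hx hxm
  rw [hg x (Ioo_subset_Ioc_self hxm)] at this
  simpa using this

/-- `H ≥ ε`: `⟨f, H f⟩ ≥ ε ‖f‖²` for all `f` in the domain of `H`. -/
def BoundedBelowBy (H : L2 →ₗ.[ℂ] L2) (ε : ℝ) : Prop :=
  ∀ f : H.domain, ε * ‖(f : L2)‖ ^ 2 ≤ (inner ℂ (f : L2) (H f)).re

/-- The singular Weyl function: `φ(z) - m(z) θ(z)` satisfies the boundary condition at `x = 1`. -/
def IsBesselWeylFunction (φ θ : ℂ → ℝ → ℂ) (β : ℝ) (m : ℂ → ℂ) : Prop :=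
  ∀ z : ℂ, z.im ≠ 0 → BCOne β (fun x => φ z x - m z * θ z x)

/-! ### The Krein string -/

/-- The measure `r(ξ) dξ` on `(0, a)`. -/
def stringMeasure (a : ℝ) (r : ℝ → ℝ) : Measure ℝ :=
  (volume.restrict (Ioo 0 a)).withDensity (fun s => ENNReal.ofReal (r s))

/-- The weighted Hilbert space `L²_r(0,a)`. -/
abbrev L2r (a : ℝ) (r : ℝ → ℝ) := Lp ℂ 2 (stringMeasure a r)

/-- The boundary condition `cos β y(a) - sin β y'(a) = 0`. -/
def BCString (a β : ℝ) (y : ℝ → ℂ) : Prop :=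
  (Real.cos β : ℂ) * y a - (Real.sin β : ℂ) * derivWithin y (Icc 0 a) a = 0

theorem derivWithin_add_Icc {a x : ℝ} {y y' : ℝ → ℂ} (hx : x = 0 ∨ x = a)
    (h : DifferentiableOn ℝ y (Icc 0 a)) (h' : DifferentiableOn ℝ y' (Icc 0 a)) :
    derivWithin (y + y') (Icc 0 a) x = derivWithin y (Icc 0 a) x + derivWithin y' (Icc 0 a) x := by
  by_cases ha : 0 ≤ a
  · have hm : x ∈ Icc 0 a := by rcases hx with rfl | rfl <;> simp [ha]
    exact derivWithin_add (h x hm) (h' x hm)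
  · have h0 : ∀ u : ℝ → ℂ, derivWithin u ∅ x = 0 := fun u =>
      derivWithin_zero_of_notMem_closure (by simp)
    simp only [Icc_eq_empty ha, h0, add_zero]

theorem derivWithin_smul_Icc {a x : ℝ} {y : ℝ → ℂ} (c : ℂ) (hx : x = 0 ∨ x = a)
    (h : DifferentiableOn ℝ y (Icc 0 a)) :
    derivWithin (c • y) (Icc 0 a) x = c * derivWithin y (Icc 0 a) x := by
  by_cases ha : 0 ≤ a
  · have hm : x ∈ Icc 0 a := by rcases hx with rfl | rfl <;> simp [ha]
    exact derivWithin_const_smul c (h x hm)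
  · have h0 : ∀ u : ℝ → ℂ, derivWithin u ∅ x = 0 := fun u =>
      derivWithin_zero_of_notMem_closure (by simp)
    simp only [Icc_eq_empty ha, h0, mul_zero]

/-- The graph of the Krein string operator `L = -(1/r) d²/dξ²` in `L²_r(0,a)`: the pairs `(u, h)`
such that `u` has a representative `y` with `y' ∈ AC[0,a]`, `-y'' = r h`, `y'(0) = 0` and
`cos β y(a) - sin β y'(a) = 0`. -/
def stringGraph (a : ℝ) (r : ℝ → ℝ) (β : ℝ) : Submodule ℂ (L2r a r × L2r a r) where
  carrier := {p | ∃ y k : ℝ → ℂ, (p.1 : ℝ → ℂ) =ᵐ[stringMeasure a r] y ∧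
    (p.2 : ℝ → ℂ) =ᵐ[stringMeasure a r] k ∧
    HasSecondDeriv (Icc 0 a) y (fun s => -((r s : ℂ) * k s)) ∧
    derivWithin y (Icc 0 a) 0 = 0 ∧ BCString a β y}
  add_mem' := by
    rintro p p' ⟨g, k, h1, h2, h3, h4, h5⟩ ⟨g', k', h1', h2', h3', h4', h5'⟩
    refine ⟨g + g', k + k', ((Lp.coeFn_add p.1 p'.1).trans (h1.add h1')),
      ((Lp.coeFn_add p.2 p'.2).trans (h2.add h2')), ?_, ?_, ?_⟩
    · convert h3.add h3' using 1
      funext x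
      simp only [Pi.add_apply]
      ring
    · rw [derivWithin_add_Icc (Or.inl rfl) h3.1 h3'.1, h4, h4', add_zero]
    · unfold BCString at *
      rw [derivWithin_add_Icc (Or.inr rfl) h3.1 h3'.1, Pi.add_apply]
      linear_combination h5 + h5'
  zero_mem' := by
    have hd : ∀ x, derivWithin (0 : ℝ → ℂ) (Icc 0 a) x = 0 := fun x =>
      congrFun (derivWithin_const (s := Icc (0 : ℝ) a) (c := (0 : ℂ))) x
    refine ⟨0, 0, Lp.coeFn_zero ℂ 2 _, Lp.coeFn_zero ℂ 2 _, ?_, hd 0, ?_⟩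
    · convert HasSecondDeriv.zero (Icc (0 : ℝ) a) using 1
      funext x
      simp
    · simp [BCString, hd]
  smul_mem' := by
    rintro c p ⟨g, k, h1, h2, h3, h4, h5⟩
    refine ⟨c • g, c • k, (Lp.coeFn_smul c p.1).trans (h1.const_smul c),
      (Lp.coeFn_smul c p.2).trans (h2.const_smul c), ?_, ?_, ?_⟩
    · convert h3.smul c using 1
      funext x
      simp only [Pi.smul_apply, smul_eq_mul]
      ring
    · rw [derivWithin_smul_Icc c (Or.inl rfl) h3.1, h4, mul_zero]
    · unfold BCString at *
      rw [derivWithin_smul_Icc c (Or.inr rfl) h3.1, Pi.smul_apply, smul_eq_mul]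
      linear_combination c * h5

/-- The Krein string operator `L` in `L²_r(0,a)`; its graph is `stringGraph` whenever `r > 0` on
`(0,a)`, see `stringOp_graph`. -/
def stringOp (a : ℝ) (r : ℝ → ℝ) (β : ℝ) : L2r a r →ₗ.[ℂ] L2r a r :=
  (stringGraph a r β).toLinearPMap

theorem stringOp_graph {a : ℝ} {r : ℝ → ℝ} (β : ℝ)
    (hm : AEMeasurable r (volume.restrict (Ioo 0 a))) (hr : ∀ s ∈ Ioo 0 a, 0 < r s) :
    (stringOp a r β).graph = stringGraph a r β := by
  refine Submodule.toLinearPMap_graph_eq _ ?_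
  rintro ⟨f, h⟩ ⟨y, k, h1, h2, h3, -, -⟩ hf
  simp only at hf h1 h2
  have hac : ∀ u : ℝ → ℂ, u =ᵐ[stringMeasure a r] 0 → u =ᵐ[volume.restrict (Ioo 0 a)] 0 := by
    intro u hu
    have := (ae_withDensity_iff' hm.ennreal_ofReal).1 hu
    filter_upwards [this, ae_restrict_mem measurableSet_Ioo] with x hx hxm
    exact hx (by simpa using hr x hxm)
  refine (Lp.eq_zero_iff_ae_eq_zero).2 (h2.trans ?_)
  refine (withDensity_absolutelyContinuous _ _).ae_le ?_
  rcases le_or_gt a 0 with ha | ha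
  · simp [Ioo_eq_empty ha.not_gt]
  have hy0 : y =ᵐ[volume.restrict (Icc 0 a)] 0 := by
    rw [← restrict_Ioo_eq_restrict_Icc]
    rw [hf] at h1
    exact hac y (h1.symm.trans (Lp.coeFn_zero ℂ 2 _))
  have hy : ∀ x ∈ Icc 0 a, y x = 0 := fun x hx =>
    Measure.eqOn_Icc_of_ae_eq volume ha.ne hy0 h3.1.continuousOn continuousOn_const hx
  have hk := h3.ae_eq_zero Ioo_subset_Icc_self hy
  filter_upwards [ae_restrict_of_ae hk, ae_restrict_mem measurableSet_Ioo] with x hx hxm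
  have := hx hxm
  simpa [(hr x hxm).ne'] using this

/-- `c(z,ξ)`, `s(z,ξ)` are the fundamental solutions of `-y'' = z r y` on `[0,a]`, with
`c(z,0) = s'(z,0) = 1` and `c'(z,0) = s(z,0) = 0`. -/
structure IsStringSystem (a : ℝ) (r : ℝ → ℝ) (c s : ℂ → ℝ → ℂ) : Prop where
  solves_c : ∀ z, HasSecondDeriv (Icc 0 a) (c z) (fun ξ => -(z * r ξ * c z ξ))
  solves_s : ∀ z, HasSecondDeriv (Icc 0 a) (s z) (fun ξ => -(z * r ξ * s z ξ))
  c_zero : ∀ z, c z 0 = 1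
  c_deriv_zero : ∀ z, derivWithin (c z) (Icc 0 a) 0 = 0
  s_zero : ∀ z, s z 0 = 0
  s_deriv_zero : ∀ z, derivWithin (s z) (Icc 0 a) 0 = 1

/-- The `m`-function of the string: `s(z) - M(z) c(z)` satisfies the boundary condition at `a`. -/
def IsStringWeylFunction (a : ℝ) (c s : ℂ → ℝ → ℂ) (β : ℝ) (M : ℂ → ℂ) : Prop :=
  ∀ z : ℂ, z.im ≠ 0 → BCString a β (fun ξ => s z ξ - M z * c z ξ)

/-! ### The Liouville-type transform -/

/-- `ξ(x) = ∫₀ˣ dt / θ₀(t)²`. -/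
def xi (θ₀ : ℝ → ℝ) (x : ℝ) : ℝ := ∫ t in (0 : ℝ)..x, 1 / θ₀ t ^ 2

/-- The inverse function `x(ξ)` of `ξ(x)`, `x ∈ [0,1]`. -/
def xiInv (θ₀ : ℝ → ℝ) : ℝ → ℝ := Function.invFunOn (xi θ₀) (Icc 0 1)

/-- The length `a = ξ(1)` of the string. -/
def stringLength (θ₀ : ℝ → ℝ) : ℝ := xi θ₀ 1

/-- The weight `r(ξ) = θ₀(x)⁴`, `ξ = ξ(x)`. -/
def stringWeight (θ₀ : ℝ → ℝ) (s : ℝ) : ℝ := θ₀ (xiInv θ₀ s) ^ 4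

/-- The transform `v(x) ↦ u(ξ) = v(x) / θ₀(x)`, `ξ = ξ(x)`, on functions. -/
def liouville (θ₀ : ℝ → ℝ) (v : ℝ → ℂ) (s : ℝ) : ℂ := v (xiInv θ₀ s) / (θ₀ (xiInv θ₀ s) : ℂ)

/-- The relation between the boundary parameters `β, β' ∈ [0, π)` at `x = 1` and at `ξ = a`:
`cot β' = θ₀(1) (θ₀(1) cot β - θ₀'(1))`, where `β' = 0` iff `β = 0` (both cotangents infinite). -/
def AnglesRelated (θ₀ : ℝ → ℝ) (β β' : ℝ) : Prop :=
  (β = 0 ∧ β' = 0) ∨ (β ≠ 0 ∧ β' ≠ 0 ∧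
    Real.cot β' = θ₀ 1 * (θ₀ 1 * Real.cot β - derivWithin θ₀ (Ioc 0 1) 1))

end PerturbedBessel

end

/-!
The proof is a Liouville transformation based on the solution `θ₀ = θ(0, ·)` of energy zero.

*Positivity.* If `θ₀` vanished at some `x₀ ∈ (0, 1]`, then `θ₀(x) = O(x₀ - x)` there. Multiplying
`θ₀` by a cut-off `γ` that drops from `1` to `0` between `x₀ - 2δ` and `x₀ - δ` gives an element of
the domain of `H` with `⟨θ₀γ, H θ₀γ⟩ = ∫ θ₀² γ'² = O(δ)` (`BoundedBelowBy.integral_le`), while its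
norm stays bounded from below, contradicting `H ≥ ε` (`BoundedBelowBy.ne_zero`). The cut-off is
smooth, so the test function really is in the operator domain although `q` is only locally
integrable.

*Change of variables.* Near `0`, `θ₀` is comparable with `singularFactor l`, and
`1 / singularFactor²` is the derivative of `x ^ (l + 1) / singularFactor l x`
(`hasDerivAt_leadingRatio`), which tends to `0`. Hence `1 / θ₀²` is integrable and `ξ` is a `C¹`
diffeomorphism of `(0, 1]` onto `(0, a]`. Since `r dξ = θ₀² dx`, division by `θ₀` is unitary
(`IsLiouvilleWeight.exists_unitary`).

*The equation.* For `y(ξ) = g(x) / θ₀(x)` one has `dy/dξ = W(θ₀, g)` and, because `τ θ₀ = 0`,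
`dW(θ₀, g)/dx = -θ₀ τ g`, that is `-y'' = r (τ g / θ₀)`. The right-hand side is integrable up to
`ξ = 0`, so `y` and `y'` extend continuously to `ξ = 0`
(`IsLiouvilleWeight.hasSecondDeriv_liouville`); conversely solutions on the string are pulled back
(`IsLiouvilleWeight.hasSecondDeriv_pullback`). The identity
`W(g, θ(λ₀)) = (g / θ₀) W(θ₀, θ(λ₀)) - (θ(λ₀) / θ₀) W(θ₀, g)` shows that the limit of
`W(g, θ(λ₀))` at `0` is `-y'(0)`, which turns the boundary condition at `0` into `y'(0) = 0`. The
boundary forms at `1` and `a` are proportional (`IsLiouvilleWeight.exists_boundary_factor`).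

*Fundamental solutions and `m`-functions.* `θ(z) / θ₀` and `φ(z) / θ₀` solve the string equation
with the right initial values, the slope of the latter being the limit of `φ(z) / (θ₀ ξ)`, and
solutions are unique because Wronskians are constant (`string_solution_eq`). The `m`-functions are
quotients of boundary forms; the denominator does not vanish for non-real `z`, since otherwise
Lagrange's identity for `y` and its conjugate would give `∫ r |y|² = 0`
(`im_eq_zero_of_BCString`).
-/

namespace PerturbedBessel

/-! ### Calculus of locally absolutely continuous functions -/

/-- The primitive of an integrable complex-valued function is absolutely continuous; the bound comes
from the primitive of its norm. -/
theorem absolutelyContinuousOnInterval_primitive {u : ℝ → ℂ} {a b : ℝ} (hab : a ≤ b)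
    (hu : IntervalIntegrable u volume a b) :
    AbsolutelyContinuousOnInterval (fun x => ∫ t in a..x, u t) a b := by
  have hn := hu.norm.absolutelyContinuousOnInterval_intervalIntegral (c := a) left_mem_uIcc
  unfold AbsolutelyContinuousOnInterval at hn ⊢
  refine squeeze_zero' (Eventually.of_forall fun _ => Finset.sum_nonneg fun _ _ => dist_nonneg)
    ?_ hn
  rw [eventually_inf_principal]
  refine Eventually.of_forall fun E hE => Finset.sum_le_sum fun i hi => ?_
  obtain ⟨h1, h2⟩ := hE.1 i hi
  have hsub : ∀ t ∈ uIcc a b, IntervalIntegrable u volume a t := fun t ht =>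
    hu.mono_set (by rw [uIcc_of_le hab] at *; rw [uIcc_of_le ht.1]; exact Icc_subset_Icc_right ht.2)
  rw [dist_comm, dist_comm (∫ t in a..(E.2 i).1, ‖u t‖), Real.dist_eq, dist_eq_norm,
    intervalIntegral.integral_interval_sub_left (hsub _ h2) (hsub _ h1),
    intervalIntegral.integral_interval_sub_left (hsub _ h2).norm (hsub _ h1).norm]
  exact intervalIntegral.norm_integral_le_abs_integral_norm

namespace IsACWithDeriv

variable {I : Set ℝ} {F G u v : ℝ → ℂ}

theorem congr_deriv (hI : I.OrdConnected) (hF : IsACWithDeriv I F u) (h : EqOn u v I) :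
    IsACWithDeriv I F v := by
  intro x hx y hy hxy
  obtain ⟨h1, h2⟩ := hF x hx y hy hxy
  have hs : EqOn u v (uIcc x y) := by
    rw [uIcc_of_le hxy]
    exact h.mono (hI.out hx hy)
  exact ⟨h1.congr fun t ht => hs (uIoc_subset_uIcc ht),
    h2.trans (intervalIntegral.integral_congr hs)⟩

/-- On a closed interval, the values of the derivative at the left endpoint are irrelevant. -/
theorem congr_deriv_Icc {a b : ℝ} (hF : IsACWithDeriv (Icc a b) F u) (h : EqOn u v (Ioc a b)) :
    IsACWithDeriv (Icc a b) F v := by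
  intro x hx y hy hxy
  obtain ⟨h1, h2⟩ := hF x hx y hy hxy
  have hs : EqOn u v (uIoc x y) := by
    rw [uIoc_of_le hxy]
    exact h.mono (Ioc_subset_Ioc hx.1 hy.2)
  exact ⟨h1.congr hs,
    h2.trans (intervalIntegral.integral_congr_ae (Eventually.of_forall fun t ht => hs ht))⟩

theorem continuousOn_Icc (hF : IsACWithDeriv I F u) {x y : ℝ} (hI : Icc x y ⊆ I) (hxy : x ≤ y) :
    ContinuousOn F (Icc x y) := by
  have hx := hI (left_mem_Icc.2 hxy)
  have h := intervalIntegral.continuousOn_primitive_interval'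
    (hF x hx y (hI (right_mem_Icc.2 hxy)) hxy).1 left_mem_uIcc
  rw [uIcc_of_le hxy] at h
  refine (h.const_add (F x)).congr fun t ht => ?_
  change F t = F x + ∫ s in x..t, u s
  rw [← (hF x hx t (hI ht) ht.1).2]
  ring

theorem continuousOn (hI : I.OrdConnected) (hF : IsACWithDeriv I F u) : ContinuousOn F I := by
  intro x hx
  have hl : ContinuousWithinAt F (I ∩ Iic x) x := by
    by_cases h : ∃ y ∈ I, y < x
    · obtain ⟨y, hy, hyx⟩ := h
      have := (hF.continuousOn_Icc (hI.out hy hx) hyx.le) x (right_mem_Icc.2 hyx.le)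
      refine this.mono_of_mem_nhdsWithin ?_
      exact mem_of_superset (inter_mem_nhdsWithin _ (Ioi_mem_nhds hyx)) fun t ht =>
        ⟨ht.2.le, ht.1.2⟩
    · refine continuousWithinAt_singleton.mono fun t ht => ?_
      exact le_antisymm ht.2 (not_lt.1 fun hlt => h ⟨t, ht.1, hlt⟩)
  have hr : ContinuousWithinAt F (I ∩ Ici x) x := by
    by_cases h : ∃ y ∈ I, x < y
    · obtain ⟨y, hy, hyx⟩ := h
      have := (hF.continuousOn_Icc (hI.out hx hy) hyx.le) x (left_mem_Icc.2 hyx.le)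
      refine this.mono_of_mem_nhdsWithin ?_
      exact mem_of_superset (inter_mem_nhdsWithin _ (Iio_mem_nhds hyx)) fun t ht =>
        ⟨ht.1.2, ht.2.le⟩
    · refine continuousWithinAt_singleton.mono fun t ht => ?_
      exact le_antisymm (not_lt.1 fun hlt => h ⟨t, ht.1, hlt⟩) ht.2
  have := hl.union hr
  rwa [← inter_union_distrib_left, Iic_union_Ici, inter_univ] at this

/-- **Product rule** for locally absolutely continuous functions. -/
theorem mul (hI : I.OrdConnected) (hF : IsACWithDeriv I F u) (hG : IsACWithDeriv I G v) :
    IsACWithDeriv I (fun x => F x * G x) (fun x => u x * G x + F x * v x) := by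
  intro x hx y hy hxy
  have hsub : Icc x y ⊆ I := hI.out hx hy
  have hu := (hF x hx y hy hxy).1
  have hv := (hG x hx y hy hxy).1
  have hFc := hF.continuousOn_Icc hsub hxy
  have hGc := hG.continuousOn_Icc hsub hxy
  have hw : IntervalIntegrable (fun t => u t * G t + F t * v t) volume x y :=
    (hu.mul_continuousOn (by rwa [uIcc_of_le hxy])).add
      (hv.continuousOn_mul (by rwa [uIcc_of_le hxy]))
  refine ⟨hw, ?_⟩
  have hconst : ∀ c : ℂ, AbsolutelyContinuousOnInterval (fun _ : ℝ => c) x y := fun c =>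
    ((LipschitzWith.const c).lipschitzOnWith).absolutelyContinuousOnInterval
  -- The difference of both sides, with `F` and `G` replaced by primitives of `u` and `v`, is
  -- absolutely continuous with derivative zero almost everywhere.
  set f : ℝ → ℂ := fun t => F x + ∫ s in x..t, u s with hf
  set g : ℝ → ℂ := fun t => G x + ∫ s in x..t, v s with hg
  have hfF : ∀ t ∈ Icc x y, f t = F t := fun t ht => by
    rw [hf]; simp only; rw [← (hF x hx t (hsub ht) ht.1).2]; ring
  have hgG : ∀ t ∈ Icc x y, g t = G t := fun t ht => by
    rw [hg]; simp only; rw [← (hG x hx t (hsub ht) ht.1).2]; ring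
  have hfa : AbsolutelyContinuousOnInterval f x y :=
    (hconst _).add (absolutelyContinuousOnInterval_primitive hxy hu)
  have hga : AbsolutelyContinuousOnInterval g x y :=
    (hconst _).add (absolutelyContinuousOnInterval_primitive hxy hv)
  have hda := (hfa.smul hga).sub (absolutelyContinuousOnInterval_primitive hxy hw)
  obtain ⟨C, hC⟩ := hda.const_of_ae_hasDerivAt_zero (by
    filter_upwards [hu.ae_hasDerivAt_integral, hv.ae_hasDerivAt_integral,
      hw.ae_hasDerivAt_integral] with t h1 h2 h3 ht
    have d := (((h1 ht x left_mem_uIcc).const_add (F x)).mul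
      ((h2 ht x left_mem_uIcc).const_add (G x))).sub (h3 ht x left_mem_uIcc)
    have ht' : t ∈ Icc x y := by rwa [uIcc_of_le hxy] at ht
    have e1 := hfF t ht'
    have e2 := hgG t ht'
    simp only [hf, hg] at e1 e2
    rw [e1, e2, sub_self] at d
    exact d)
  have h1 := hC x left_mem_uIcc
  have h2 := hC y right_mem_uIcc
  simp only [Pi.sub_apply, smul_eq_mul, Pi.mul_apply, intervalIntegral.integral_same, sub_zero]
    at h1 h2
  rw [hfF _ (left_mem_Icc.2 hxy), hgG _ (left_mem_Icc.2 hxy)] at h1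
  rw [hfF _ (right_mem_Icc.2 hxy), hgG _ (right_mem_Icc.2 hxy)] at h2
  linear_combination h2 - h1

/-- A continuously differentiable function on an interval is locally absolutely continuous. -/
theorem of_hasDerivWithinAt (hI : I.OrdConnected) (hF : ∀ x ∈ I, HasDerivWithinAt F (u x) I x)
    (hu : ContinuousOn u I) : IsACWithDeriv I F u := by
  intro x hx y hy hxy
  have hsub : Icc x y ⊆ I := hI.out hx hy
  have hint : IntervalIntegrable u volume x y :=
    (hu.mono (by rwa [uIcc_of_le hxy])).intervalIntegrable
  refine ⟨hint, (intervalIntegral.integral_eq_sub_of_hasDerivAt_of_le hxy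
    (fun t ht => ((hF t (hsub ht)).mono hsub).continuousWithinAt) (fun t ht => ?_) hint).symm⟩
  exact ((hF t (hsub (Ioo_subset_Icc_self ht))).mono hsub).hasDerivAt (Icc_mem_nhds ht.1 ht.2)

/-- If the derivative in the integral sense is continuous on `[a, b]`, it is a classical
derivative. -/
theorem hasDerivWithinAt {a b : ℝ} (hF : IsACWithDeriv (Icc a b) F u)
    (hu : ContinuousOn u (Icc a b)) {x : ℝ} (hx : x ∈ Icc a b) :
    HasDerivWithinAt F (u x) (Icc a b) x := by
  have hab : a ≤ b := hx.1.trans hx.2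
  have hint : IntervalIntegrable u volume a x := (hF a (left_mem_Icc.2 hab) x hx hx.1).1
  have : Fact (x ∈ Icc a b) := ⟨hx⟩
  have h := intervalIntegral.integral_hasDerivWithinAt_right hint (s := Icc a b) (t := Icc a b)
    (hu.stronglyMeasurableAtFilter_nhdsWithin measurableSet_Icc x) (hu x hx)
  refine (h.const_add (F a)).congr_of_mem (fun t ht => ?_) hx
  rw [← (hF a (left_mem_Icc.2 hab) t ht ht.1).2]
  ring

theorem conj (hF : IsACWithDeriv I F u) :
    IsACWithDeriv I (fun x => (starRingEnd ℂ) (F x)) (fun x => (starRingEnd ℂ) (u x)) := by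
  intro x hx y hy hxy
  obtain ⟨h1, h2⟩ := hF x hx y hy hxy
  refine ⟨⟨?_, ?_⟩, ?_⟩
  · exact (Complex.conjCLE : ℂ →L[ℝ] ℂ).integrable_comp h1.1
  · exact (Complex.conjCLE : ℂ →L[ℝ] ℂ).integrable_comp h1.2
  · rw [← map_sub, h2]
    exact ((Complex.conjCLE : ℂ →L[ℝ] ℂ).intervalIntegral_comp_comm h1).symm

/-- If the derivative is integrable up to the left endpoint `0`, the function extends to an
absolutely continuous function on the closed interval. -/
theorem exists_extension {b : ℝ} (hb : 0 < b) (hF : IsACWithDeriv (Ioc 0 b) F u)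
    (hu : IntegrableOn u (Ioc 0 b)) :
    ∃ C, Tendsto F (𝓝[>] 0) (𝓝 C) ∧ IsACWithDeriv (Icc 0 b) (Function.update F 0 C) u := by
  have hint : ∀ x ∈ Icc 0 b, ∀ y ∈ Icc 0 b, x ≤ y → IntervalIntegrable u volume x y :=
    fun x hx y hy hxy => (intervalIntegrable_iff_integrableOn_Ioc_of_le hxy).2
      (hu.mono_set (Ioc_subset_Ioc hx.1 hy.2))
  have h0b := hint 0 (left_mem_Icc.2 hb.le) b (right_mem_Icc.2 hb.le) hb.le
  have heq : ∀ t ∈ Icc 0 b, Function.update F 0 (F b - ∫ s in (0 : ℝ)..b, u s) t =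
      (F b - ∫ s in (0 : ℝ)..b, u s) + ∫ s in (0 : ℝ)..t, u s := by
    intro t ht
    rcases ht.1.eq_or_lt with rfl | h
    · simp
    · rw [Function.update_of_ne h.ne', ← intervalIntegral.integral_add_adjacent_intervals
        (hint 0 (left_mem_Icc.2 hb.le) t ht ht.1) (hint t ht b (right_mem_Icc.2 hb.le) ht.2),
        ← (hF t ⟨h, ht.2⟩ b (right_mem_Ioc.2 hb) ht.2).2]
      ring
  refine ⟨F b - ∫ s in (0 : ℝ)..b, u s, ?_, ?_⟩
  · have hc := intervalIntegral.continuousOn_primitive_interval' h0b left_mem_uIcc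
    rw [uIcc_of_le hb.le] at hc
    have := ((hc 0 (left_mem_Icc.2 hb.le)).mono Ioc_subset_Icc_self).tendsto.const_add
      (F b - ∫ s in (0 : ℝ)..b, u s)
    rw [intervalIntegral.integral_same, add_zero, nhdsWithin_Ioc_eq_nhdsGT hb] at this
    refine this.congr' ?_
    filter_upwards [Ioc_mem_nhdsGT hb] with t ht
    rw [← heq t (Ioc_subset_Icc_self ht), Function.update_of_ne ht.1.ne']
  · intro x hx y hy hxy
    refine ⟨hint x hx y hy hxy, ?_⟩
    rw [heq x hx, heq y hy, add_sub_add_left_eq_sub, intervalIntegral.integral_interval_sub_left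
      (hint 0 (left_mem_Icc.2 hb.le) y hy hy.1) (hint 0 (left_mem_Icc.2 hb.le) x hx hx.1)]

/-- Change of variables by an increasing differentiable bijection of intervals. -/
theorem comp {J : Set ℝ} {ψ ψ' : ℝ → ℝ} (hJ : J.OrdConnected) (hF : IsACWithDeriv I F u)
    (hm : MapsTo ψ J I) (hmono : StrictMonoOn ψ J)
    (hd : ∀ x ∈ J, HasDerivWithinAt ψ (ψ' x) J x) (hpos : ∀ x ∈ J, 0 ≤ ψ' x) :
    IsACWithDeriv J (fun x => F (ψ x)) (fun x => (ψ' x : ℂ) * u (ψ x)) := by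
  intro x hx y hy hxy
  have hsub : Icc x y ⊆ J := hJ.out hx hy
  have hle : ψ x ≤ ψ y := hmono.monotoneOn hx hy hxy
  obtain ⟨h1, h2⟩ := hF _ (hm hx) _ (hm hy) hle
  have himg : ψ '' Icc x y = Icc (ψ x) (ψ y) := by
    refine Subset.antisymm ?_ (intermediate_value_Icc hxy fun t ht =>
      ((hd t (hsub ht)).mono hsub).continuousWithinAt)
    rintro _ ⟨t, ht, rfl⟩
    exact ⟨hmono.monotoneOn hx (hsub ht) ht.1, hmono.monotoneOn (hsub ht) hy ht.2⟩
  have hd' : ∀ t ∈ Icc x y, HasDerivWithinAt ψ (ψ' t) (Icc x y) t := fun t ht =>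
    (hd t (hsub ht)).mono hsub
  have hinj := hmono.injOn.mono hsub
  have hfun : EqOn (fun t => |ψ' t| • u (ψ t)) (fun t => (ψ' t : ℂ) * u (ψ t)) (Icc x y) :=
    fun t ht => by simp only [abs_of_nonneg (hpos t (hsub ht)), Complex.real_smul]
  rw [intervalIntegrable_iff_integrableOn_Icc_of_le hle, ← himg,
    integrableOn_image_iff_integrableOn_abs_deriv_smul measurableSet_Icc hd' hinj] at h1
  rw [intervalIntegral.integral_of_le hle, ← integral_Icc_eq_integral_Ioc, ← himg,
    integral_image_eq_integral_abs_deriv_smul measurableSet_Icc hd' hinj,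
    setIntegral_congr_fun measurableSet_Icc hfun] at h2
  rw [intervalIntegrable_iff_integrableOn_Icc_of_le hxy, intervalIntegral.integral_of_le hxy,
    ← integral_Icc_eq_integral_Ioc]
  exact ⟨h1.congr_fun hfun measurableSet_Icc, h2⟩

end IsACWithDeriv

namespace HasSecondDeriv

variable {I : Set ℝ} {g w : ℝ → ℂ}

theorem hasDerivWithinAt (hg : HasSecondDeriv I g w) {x : ℝ} (hx : x ∈ I) :
    HasDerivWithinAt g (derivWithin g I x) I x :=
  (hg.1 x hx).hasDerivWithinAt

theorem continuousOn_derivWithin (hI : I.OrdConnected) (hg : HasSecondDeriv I g w) :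
    ContinuousOn (derivWithin g I) I :=
  hg.2.continuousOn hI

theorem isACWithDeriv (hI : I.OrdConnected) (hg : HasSecondDeriv I g w) :
    IsACWithDeriv I g (derivWithin g I) :=
  .of_hasDerivWithinAt hI (fun _ hx => hg.hasDerivWithinAt hx) (hg.continuousOn_derivWithin hI)

theorem of_hasDerivWithinAt (hI : UniqueDiffOn ℝ I) {g' : ℝ → ℂ}
    (hg : ∀ x ∈ I, HasDerivWithinAt g (g' x) I x) (hg' : IsACWithDeriv I g' w) :
    HasSecondDeriv I g w :=
  ⟨fun x hx => (hg x hx).differentiableWithinAt,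
    hg'.congr_left fun x hx => ((hg x hx).derivWithin (hI x hx)).symm⟩

theorem congr {f : ℝ → ℂ} (hg : HasSecondDeriv I g w) (h : EqOn f g I) : HasSecondDeriv I f w :=
  ⟨hg.1.congr h, hg.2.congr_left fun _ hx => (derivWithin_congr h (h hx)).symm⟩

theorem congr_deriv {v : ℝ → ℂ} (hI : I.OrdConnected) (hg : HasSecondDeriv I g w)
    (h : EqOn w v I) : HasSecondDeriv I g v :=
  ⟨hg.1, hg.2.congr_deriv hI h⟩

end HasSecondDeriv

/-- Lagrange's identity: the Wronskian of two functions is locally absolutely continuous with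
derivative `f g'' - f'' g`. -/
theorem HasSecondDeriv.lagrange {I : Set ℝ} {f g u v : ℝ → ℂ} (hI : I.OrdConnected)
    (hf : HasSecondDeriv I f u) (hg : HasSecondDeriv I g v) :
    IsACWithDeriv I (fun x => f x * derivWithin g I x - derivWithin f I x * g x)
      (fun x => f x * v x - u x * g x) := by
  have h := ((hf.isACWithDeriv hI).mul hI hg.2).add
    ((hf.2.mul hI (hg.isACWithDeriv hI)).smul (-1))
  refine (h.congr_left fun _ _ => ?_).congr_deriv hI fun _ _ => ?_
  · simp only [Pi.add_apply, Pi.smul_apply, smul_eq_mul]; ring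
  · simp only [Pi.add_apply, Pi.smul_apply, smul_eq_mul]; ring

theorem HasSecondDeriv.conj {I : Set ℝ} {g w : ℝ → ℂ} (hI : UniqueDiffOn ℝ I)
    (hg : HasSecondDeriv I g w) :
    HasSecondDeriv I (fun x => (starRingEnd ℂ) (g x)) (fun x => (starRingEnd ℂ) (w x)) :=
  .of_hasDerivWithinAt hI
    (fun _ hx => (Complex.conjCLE : ℂ →L[ℝ] ℂ).hasFDerivAt.comp_hasDerivWithinAt _
      (hg.hasDerivWithinAt hx)) hg.2.conj

/-! ### The change of variables `ξ = ∫₀ˣ dt / θ₀(t)²` -/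

/-- A positive continuous function on `(0, 1]` with `1 / θ₀² ∈ L¹(0, 1)`. The value `θ₀ 0` is
irrelevant. -/
structure IsLiouvilleWeight (θ₀ : ℝ → ℝ) : Prop where
  pos : ∀ x ∈ Ioc (0 : ℝ) 1, 0 < θ₀ x
  continuousOn : ContinuousOn θ₀ (Ioc 0 1)
  integrableOn : IntegrableOn (fun x => 1 / θ₀ x ^ 2) (Ioo 0 1)

namespace IsLiouvilleWeight

variable {θ₀ : ℝ → ℝ} (h : IsLiouvilleWeight θ₀)
include h

theorem intervalIntegrable {x y : ℝ} (hx : x ∈ Icc (0 : ℝ) 1) (hy : y ∈ Icc (0 : ℝ) 1)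
    (hxy : x ≤ y) : IntervalIntegrable (fun t => 1 / θ₀ t ^ 2) volume x y := by
  rw [intervalIntegrable_iff_integrableOn_Ioc_of_le hxy]
  exact ((integrableOn_Ioc_iff_integrableOn_Ioo (by simp)).2 h.integrableOn).mono_set
    (Ioc_subset_Ioc hx.1 hy.2)

theorem continuousOn_density : ContinuousOn (fun t => 1 / θ₀ t ^ 2) (Ioc 0 1) :=
  continuousOn_const.div (h.continuousOn.pow 2) fun x hx => (pow_pos (h.pos x hx) 2).ne'

omit h in
theorem xi_zero : xi θ₀ 0 = 0 := intervalIntegral.integral_same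

theorem xi_continuousOn : ContinuousOn (xi θ₀) (Icc 0 1) := by
  have := intervalIntegral.continuousOn_primitive_interval' (h.intervalIntegrable
    (left_mem_Icc.2 zero_le_one) (right_mem_Icc.2 zero_le_one) zero_le_one) left_mem_uIcc
  rwa [uIcc_of_le zero_le_one] at this

theorem xi_strictMonoOn : StrictMonoOn (xi θ₀) (Icc 0 1) := by
  intro x hx y hy hxy
  have h0 : (0 : ℝ) ∈ Icc (0 : ℝ) 1 := left_mem_Icc.2 zero_le_one
  have hsub : xi θ₀ y - xi θ₀ x = ∫ t in x..y, 1 / θ₀ t ^ 2 :=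
    intervalIntegral.integral_interval_sub_left (h.intervalIntegrable h0 hy hy.1)
      (h.intervalIntegrable h0 hx hx.1)
  have hpos := intervalIntegral.intervalIntegral_pos_of_pos_on
    (h.intervalIntegrable hx hy hxy.le) (fun t ht => ?_) hxy
  · linarith
  · have := h.pos t ⟨hx.1.trans_lt ht.1, ht.2.le.trans hy.2⟩
    positivity

theorem xi_mem_Ioc {x : ℝ} (hx : x ∈ Ioc (0 : ℝ) 1) : xi θ₀ x ∈ Ioc 0 (stringLength θ₀) := by
  refine ⟨?_, h.xi_strictMonoOn.monotoneOn (Ioc_subset_Icc_self hx)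
    (right_mem_Icc.2 zero_le_one) hx.2⟩
  have := h.xi_strictMonoOn (left_mem_Icc.2 zero_le_one) (Ioc_subset_Icc_self hx) hx.1
  rwa [xi_zero] at this

theorem stringLength_pos : 0 < stringLength θ₀ := (h.xi_mem_Ioc (right_mem_Ioc.2 zero_lt_one)).1

theorem xi_bijOn : BijOn (xi θ₀) (Icc 0 1) (Icc 0 (stringLength θ₀)) := by
  refine ⟨fun x hx => ?_, h.xi_strictMonoOn.injOn, ?_⟩
  · have h1 := h.xi_strictMonoOn.monotoneOn (left_mem_Icc.2 zero_le_one) hx hx.1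
    rw [xi_zero] at h1
    exact ⟨h1, h.xi_strictMonoOn.monotoneOn hx (right_mem_Icc.2 zero_le_one) hx.2⟩
  · have := intermediate_value_Icc zero_le_one h.xi_continuousOn
    rwa [xi_zero] at this

theorem xiInv_xi {x : ℝ} (hx : x ∈ Icc (0 : ℝ) 1) : xiInv θ₀ (xi θ₀ x) = x :=
  h.xi_bijOn.injOn.leftInvOn_invFunOn hx

theorem xi_xiInv {s : ℝ} (hs : s ∈ Icc 0 (stringLength θ₀)) : xi θ₀ (xiInv θ₀ s) = s :=
  h.xi_bijOn.surjOn.rightInvOn_invFunOn hs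

theorem xiInv_mem_Icc {s : ℝ} (hs : s ∈ Icc 0 (stringLength θ₀)) :
    xiInv θ₀ s ∈ Icc (0 : ℝ) 1 :=
  h.xi_bijOn.surjOn.mapsTo_invFunOn hs

theorem xiInv_mem_Ioc {s : ℝ} (hs : s ∈ Ioc 0 (stringLength θ₀)) :
    xiInv θ₀ s ∈ Ioc (0 : ℝ) 1 := by
  have h1 := h.xiInv_mem_Icc (Ioc_subset_Icc_self hs)
  refine ⟨h1.1.lt_of_ne fun h0 => ?_, h1.2⟩
  have := h.xi_xiInv (Ioc_subset_Icc_self hs)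
  rw [← h0, xi_zero] at this
  exact hs.1.ne this

theorem xiInv_stringLength : xiInv θ₀ (stringLength θ₀) = 1 :=
  h.xiInv_xi (right_mem_Icc.2 zero_le_one)

theorem xi_mem_Ioo {x : ℝ} (hx : x ∈ Ioo (0 : ℝ) 1) : xi θ₀ x ∈ Ioo 0 (stringLength θ₀) :=
  ⟨(h.xi_mem_Ioc (Ioo_subset_Ioc_self hx)).1,
    h.xi_strictMonoOn (Ioo_subset_Icc_self hx) (right_mem_Icc.2 zero_le_one) hx.2⟩

theorem xiInv_mem_Ioo {s : ℝ} (hs : s ∈ Ioo 0 (stringLength θ₀)) :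
    xiInv θ₀ s ∈ Ioo (0 : ℝ) 1 := by
  have h1 := h.xiInv_mem_Ioc (Ioo_subset_Ioc_self hs)
  refine ⟨h1.1, h1.2.lt_of_ne fun h0 => ?_⟩
  have := h.xi_xiInv (Ioo_subset_Icc_self hs)
  rw [h0] at this
  exact hs.2.ne this.symm

theorem image_xi_Ioc : xi θ₀ '' Ioc 0 1 = Ioc 0 (stringLength θ₀) :=
  Subset.antisymm (image_subset_iff.2 fun _ hx => h.xi_mem_Ioc hx) fun _ hs =>
    ⟨_, h.xiInv_mem_Ioc hs, h.xi_xiInv (Ioc_subset_Icc_self hs)⟩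

theorem image_xi_Ioo : xi θ₀ '' Ioo 0 1 = Ioo 0 (stringLength θ₀) :=
  Subset.antisymm (image_subset_iff.2 fun _ hx => h.xi_mem_Ioo hx) fun _ hs =>
    ⟨_, h.xiInv_mem_Ioo hs, h.xi_xiInv (Ioo_subset_Icc_self hs)⟩

theorem xiInv_strictMonoOn : StrictMonoOn (xiInv θ₀) (Icc 0 (stringLength θ₀)) := by
  intro s hs t ht hst
  rw [← h.xi_xiInv hs, ← h.xi_xiInv ht] at hst
  exact (h.xi_strictMonoOn.lt_iff_lt (h.xiInv_mem_Icc hs) (h.xiInv_mem_Icc ht)).1 hst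

theorem xiInv_continuousOn : ContinuousOn (xiInv θ₀) (Icc 0 (stringLength θ₀)) := by
  set e := h.xi_strictMonoOn.orderIso (xi θ₀) (Icc 0 1)
  have hoc : OrdConnected (xi θ₀ '' Icc 0 1) := by
    rw [h.xi_bijOn.image_eq]; exact ordConnected_Icc
  have hc : Continuous fun s => (e.symm s : ℝ) := continuous_subtype_val.comp e.symm.continuous
  rw [← h.xi_bijOn.image_eq, continuousOn_iff_continuous_domRestrict]
  refine hc.congr fun s => ?_
  obtain ⟨x, rfl⟩ := e.surjective s
  rw [OrderIso.symm_apply_apply]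
  exact (h.xiInv_xi x.2).symm

theorem xi_hasDerivWithinAt {x : ℝ} (hx : x ∈ Ioc (0 : ℝ) 1) :
    HasDerivWithinAt (xi θ₀) (1 / θ₀ x ^ 2) (Ioc 0 1) x := by
  have hx' := Ioc_subset_Icc_self hx
  have hint := h.intervalIntegrable (left_mem_Icc.2 zero_le_one) hx' hx.1.le
  have hlt : x / 2 < x := half_lt_self hx.1
  have hpos : 0 < x / 2 := half_pos hx.1
  have hx'' : x ∈ Icc (x / 2) 1 := ⟨hlt.le, hx.2⟩
  have : Fact (x ∈ Icc (x / 2) 1) := ⟨hx''⟩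
  have hcont := h.continuousOn_density.mono (Icc_subset_Ioc hpos le_rfl)
  have hd := intervalIntegral.integral_hasDerivWithinAt_right hint (s := Icc (x / 2) 1)
    (t := Icc (x / 2) 1) (hcont.stronglyMeasurableAtFilter_nhdsWithin measurableSet_Icc x)
    (hcont x hx'')
  refine hd.mono_of_mem_nhdsWithin ?_
  exact mem_of_superset (inter_mem_nhdsWithin _ (Ioi_mem_nhds hlt)) fun t ht => ⟨ht.2.le, ht.1.2⟩

theorem xiInv_hasDerivWithinAt {s : ℝ} (hs : s ∈ Ioc 0 (stringLength θ₀)) :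
    HasDerivWithinAt (xiInv θ₀) (θ₀ (xiInv θ₀ s) ^ 2) (Ioc 0 (stringLength θ₀)) s := by
  have hx := h.xiInv_mem_Ioc hs
  have hne : 1 / θ₀ (xiInv θ₀ s) ^ 2 ≠ 0 := (one_div_pos.2 (pow_pos (h.pos _ hx) 2)).ne'
  have htend : Tendsto (xiInv θ₀) (𝓝[Ioc 0 (stringLength θ₀)] s) (𝓝[Ioc 0 1] (xiInv θ₀ s)) :=
    ((h.xiInv_continuousOn s (Ioc_subset_Icc_self hs)).mono
      Ioc_subset_Icc_self).tendsto_nhdsWithin fun t ht => h.xiInv_mem_Ioc ht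
  have hf : HasFDerivWithinAt (xi θ₀)
      (ContinuousLinearEquiv.unitsEquivAut ℝ (Units.mk0 _ hne) : ℝ →L[ℝ] ℝ) (Ioc 0 1)
      (xiInv θ₀ s) := h.xi_hasDerivWithinAt hx
  have := (hf.of_local_left_inverse htend hs (eventually_mem_nhdsWithin.mono fun t ht =>
    h.xi_xiInv (Ioc_subset_Icc_self ht))).hasDerivWithinAt
  refine this.congr_deriv ?_
  change (1 : ℝ) * ↑(Units.mk0 _ hne)⁻¹ = _
  simp

theorem tendsto_xi : Tendsto (xi θ₀) (𝓝[>] 0) (𝓝[>] 0) := by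
  have h0 := (h.xi_continuousOn 0 (left_mem_Icc.2 zero_le_one)).mono Ioc_subset_Icc_self
  have := h0.tendsto_nhdsWithin (t := Ioi 0) fun x hx => (h.xi_mem_Ioc hx).1
  rwa [xi_zero, nhdsWithin_Ioc_eq_nhdsGT zero_lt_one] at this

/-! ### The string weight -/

theorem stringWeight_pos {s : ℝ} (hs : s ∈ Ioc 0 (stringLength θ₀)) : 0 < stringWeight θ₀ s :=
  pow_pos (h.pos _ (h.xiInv_mem_Ioc hs)) 4

theorem continuousOn_comp_xiInv : ContinuousOn (fun s => θ₀ (xiInv θ₀ s))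
    (Ioc 0 (stringLength θ₀)) :=
  h.continuousOn.comp (h.xiInv_continuousOn.mono Ioc_subset_Icc_self) fun _ hs =>
    h.xiInv_mem_Ioc hs

theorem aemeasurable_stringWeight :
    AEMeasurable (stringWeight θ₀) (volume.restrict (Ioo 0 (stringLength θ₀))) :=
  ((h.continuousOn_comp_xiInv.mono Ioo_subset_Ioc_self).pow 4).aemeasurable measurableSet_Ioo

/-- Change of variables for integrability, with the weight of `dx = θ₀² dξ` made explicit. -/
theorem integrableOn_comp_iff {G : ℝ → ℂ} :
    IntegrableOn G (Ioc 0 (stringLength θ₀)) ↔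
      IntegrableOn (fun x => ((1 / θ₀ x ^ 2 : ℝ) : ℂ) * G (xi θ₀ x)) (Ioc 0 1) := by
  rw [← h.image_xi_Ioc, integrableOn_image_iff_integrableOn_abs_deriv_smul measurableSet_Ioc
    (fun x hx => h.xi_hasDerivWithinAt hx) (h.xi_strictMonoOn.injOn.mono Ioc_subset_Icc_self)]
  refine integrableOn_congr_fun (fun x hx => ?_) measurableSet_Ioc
  simp only [abs_of_pos (one_div_pos.2 (pow_pos (h.pos x hx) 2)), Complex.real_smul]

theorem stringWeight_xi {x : ℝ} (hx : x ∈ Icc (0 : ℝ) 1) :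
    stringWeight θ₀ (xi θ₀ x) = θ₀ x ^ 4 := by
  rw [stringWeight, h.xiInv_xi hx]

theorem liouville_xi (v : ℝ → ℂ) {x : ℝ} (hx : x ∈ Icc (0 : ℝ) 1) :
    liouville θ₀ v (xi θ₀ x) = v x / θ₀ x := by
  rw [liouville, h.xiInv_xi hx]

theorem integrableOn_stringWeight (h2 : IntegrableOn (fun x => θ₀ x ^ 2) (Ioo 0 1)) :
    IntegrableOn (stringWeight θ₀) (Ioo 0 (stringLength θ₀)) := by
  rw [← h.image_xi_Ioo, integrableOn_image_iff_integrableOn_abs_deriv_smul measurableSet_Ioo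
    (fun x hx => (h.xi_hasDerivWithinAt (Ioo_subset_Ioc_self hx)).mono Ioo_subset_Ioc_self)
    (h.xi_strictMonoOn.injOn.mono Ioo_subset_Icc_self)]
  refine h2.congr_fun (fun x hx => ?_) measurableSet_Ioo
  have hp := h.pos x (Ioo_subset_Ioc_self hx)
  simp only [h.stringWeight_xi (Ioo_subset_Icc_self hx), smul_eq_mul,
    abs_of_pos (one_div_pos.2 (pow_pos hp 2))]
  field_simp

/-! ### The unitary transform -/

/-- A property holds almost everywhere for `r(ξ) dξ` on `(0, a)` if and only if its pull-back
under `ξ` holds almost everywhere on `(0, 1)`. -/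
theorem ae_stringMeasure_iff {P : ℝ → Prop} :
    (∀ᵐ s ∂stringMeasure (stringLength θ₀) (stringWeight θ₀), P s) ↔
      ∀ᵐ x ∂volume.restrict (Ioo (0 : ℝ) 1), P (xi θ₀ x) := by
  have hr : (∀ᵐ s ∂stringMeasure (stringLength θ₀) (stringWeight θ₀), P s) ↔
      ∀ᵐ s ∂volume.restrict (Ioo 0 (stringLength θ₀)), P s := by
    rw [stringMeasure, ae_withDensity_iff' h.aemeasurable_stringWeight.ennreal_ofReal]
    refine eventually_congr ?_
    filter_upwards [ae_restrict_mem measurableSet_Ioo] with s hs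
    simp [h.stringWeight_pos (Ioo_subset_Ioc_self hs)]
  rw [hr, ae_restrict_iff' measurableSet_Ioo, ae_restrict_iff' measurableSet_Ioo, ae_iff, ae_iff]
  constructor <;> intro hN
  · refine measure_mono_null ?_
      (addHaar_image_eq_zero_of_differentiableOn_of_addHaar_eq_zero volume
        (f := xiInv θ₀) (fun s hs => ?_) hN)
    · intro x hx
      simp only [mem_ofPred_eq, Classical.not_imp] at hx
      refine ⟨xi θ₀ x, ?_, h.xiInv_xi (Ioo_subset_Icc_self hx.1)⟩
      simp only [mem_ofPred_eq, Classical.not_imp]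
      exact ⟨h.xi_mem_Ioo hx.1, hx.2⟩
    · simp only [mem_ofPred_eq, Classical.not_imp] at hs
      refine (h.xiInv_hasDerivWithinAt (Ioo_subset_Ioc_self hs.1)).differentiableWithinAt.mono ?_
      intro t ht
      simp only [mem_ofPred_eq, Classical.not_imp] at ht
      exact Ioo_subset_Ioc_self ht.1
  · refine measure_mono_null ?_
      (addHaar_image_eq_zero_of_differentiableOn_of_addHaar_eq_zero volume
        (f := xi θ₀) (fun s hs => ?_) hN)
    · intro s hs
      simp only [mem_ofPred_eq, Classical.not_imp] at hs
      refine ⟨xiInv θ₀ s, ?_, h.xi_xiInv (Ioo_subset_Icc_self hs.1)⟩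
      simp only [mem_ofPred_eq, Classical.not_imp]
      rw [h.xi_xiInv (Ioo_subset_Icc_self hs.1)]
      exact ⟨h.xiInv_mem_Ioo hs.1, hs.2⟩
    · simp only [mem_ofPred_eq, Classical.not_imp] at hs
      refine (h.xi_hasDerivWithinAt (Ioo_subset_Ioc_self hs.1)).differentiableWithinAt.mono ?_
      intro t ht
      simp only [mem_ofPred_eq, Classical.not_imp] at ht
      exact Ioo_subset_Ioc_self ht.1

/-- `r(ξ) dξ = θ₀(x)² dx`. -/
theorem lintegral_stringMeasure (G : ℝ → ENNReal) :
    ∫⁻ s, G s ∂stringMeasure (stringLength θ₀) (stringWeight θ₀) =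
      ∫⁻ x in Ioo 0 1, ENNReal.ofReal (θ₀ x ^ 2) * G (xi θ₀ x) := by
  rw [stringMeasure, lintegral_withDensity_eq_lintegral_mul_non_measurable₀ _
    h.aemeasurable_stringWeight.ennreal_ofReal (by simp), ← h.image_xi_Ioo,
    lintegral_image_eq_lintegral_abs_deriv_mul measurableSet_Ioo
    (fun x hx => (h.xi_hasDerivWithinAt (Ioo_subset_Ioc_self hx)).mono Ioo_subset_Ioc_self)
    (h.xi_strictMonoOn.injOn.mono Ioo_subset_Icc_self)]
  refine setLIntegral_congr_fun measurableSet_Ioo fun x hx => ?_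
  have hp := h.pos x (Ioo_subset_Ioc_self hx)
  simp only [Pi.mul_apply, h.stringWeight_xi (Ioo_subset_Icc_self hx)]
  rw [← mul_assoc, ← ENNReal.ofReal_mul (abs_nonneg _), abs_of_pos (one_div_pos.2 (pow_pos hp 2))]
  congr 2
  field_simp

theorem eLpNorm_stringMeasure (u : ℝ → ℂ) :
    eLpNorm u 2 (stringMeasure (stringLength θ₀) (stringWeight θ₀)) =
      eLpNorm (fun x => (θ₀ x : ℂ) * u (xi θ₀ x)) 2 (volume.restrict (Ioo (0 : ℝ) 1)) := by
  rw [eLpNorm_eq_lintegral_rpow_enorm_toReal two_ne_zero ENNReal.ofNat_ne_top,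
    eLpNorm_eq_lintegral_rpow_enorm_toReal two_ne_zero ENNReal.ofNat_ne_top,
    h.lintegral_stringMeasure]
  congr 1
  refine setLIntegral_congr_fun measurableSet_Ioo fun x hx => ?_
  have hp := h.pos x (Ioo_subset_Ioc_self hx)
  simp only [ENNReal.toReal_ofNat, enorm_mul]
  rw [ENNReal.mul_rpow_of_nonneg _ _ zero_le_two, ENNReal.rpow_two, ENNReal.rpow_two,
    ENNReal.ofReal_pow hp.le, ← ofReal_norm (θ₀ x : ℂ), Complex.norm_real,
    Real.norm_of_nonneg hp.le]

theorem mul_liouville_ae_eq (v : ℝ → ℂ) :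
    (fun x => (θ₀ x : ℂ) * liouville θ₀ v (xi θ₀ x)) =ᵐ[volume.restrict (Ioo (0 : ℝ) 1)] v := by
  filter_upwards [ae_restrict_mem measurableSet_Ioo] with x hx
  have hp := h.pos x (Ioo_subset_Ioc_self hx)
  rw [h.liouville_xi v (Ioo_subset_Icc_self hx), mul_div_cancel₀]
  exact Complex.ofReal_ne_zero.2 hp.ne'

theorem liouville_ae_congr {v w : ℝ → ℂ} (hvw : v =ᵐ[volume.restrict (Ioo (0 : ℝ) 1)] w) :
    liouville θ₀ v =ᵐ[stringMeasure (stringLength θ₀) (stringWeight θ₀)] liouville θ₀ w := by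
  refine h.ae_stringMeasure_iff.2 ?_
  filter_upwards [hvw, ae_restrict_mem measurableSet_Ioo] with x hx hxm
  rw [h.liouville_xi v (Ioo_subset_Icc_self hxm), h.liouville_xi w (Ioo_subset_Icc_self hxm), hx]

omit h in
theorem stringMeasure_absolutelyContinuous :
    stringMeasure (stringLength θ₀) (stringWeight θ₀) ≪
      volume.restrict (Ioo 0 (stringLength θ₀)) :=
  withDensity_absolutelyContinuous _ _

theorem memLp_liouville {v : ℝ → ℂ} (hv : MemLp v 2 (volume.restrict (Ioo (0 : ℝ) 1))) :
    MemLp (liouville θ₀ v) 2 (stringMeasure (stringLength θ₀) (stringWeight θ₀)) := by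
  refine ⟨?_, ?_⟩
  · obtain ⟨v', hv', hvv'⟩ := hv.1
    have h1 : AEStronglyMeasurable (fun s => v' (xiInv θ₀ s) / (θ₀ (xiInv θ₀ s) : ℂ))
        (volume.restrict (Ioo 0 (stringLength θ₀))) := by
      refine AEStronglyMeasurable.div₀ ?_ ?_
      · exact (hv'.aestronglyMeasurable (μ := Measure.map (xiInv θ₀) _)).comp_aemeasurable
          ((h.xiInv_continuousOn.mono Ioo_subset_Icc_self).aemeasurable measurableSet_Ioo)
      · exact (Complex.continuous_ofReal.comp_continuousOn
          (h.continuousOn_comp_xiInv.mono Ioo_subset_Ioc_self)).aestronglyMeasurable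
          measurableSet_Ioo
    exact (h1.mono_ac stringMeasure_absolutelyContinuous).congr (h.liouville_ae_congr hvv').symm
  · rw [h.eLpNorm_stringMeasure, eLpNorm_congr_ae (h.mul_liouville_ae_eq v)]
    exact hv.2

theorem memLp_mul_comp_xi {u : ℝ → ℂ}
    (hu : MemLp u 2 (stringMeasure (stringLength θ₀) (stringWeight θ₀))) :
    MemLp (fun x => (θ₀ x : ℂ) * u (xi θ₀ x)) 2 (volume.restrict (Ioo (0 : ℝ) 1)) := by
  refine ⟨?_, by rw [← h.eLpNorm_stringMeasure]; exact hu.2⟩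
  obtain ⟨u', hu', huu'⟩ := hu.1
  refine AEStronglyMeasurable.congr (f := fun x => (θ₀ x : ℂ) * u' (xi θ₀ x)) ?_ ?_
  · refine AEStronglyMeasurable.mul ?_ ?_
    · exact (Complex.continuous_ofReal.comp_continuousOn
        (h.continuousOn.mono Ioo_subset_Ioc_self)).aestronglyMeasurable measurableSet_Ioo
    · exact (hu'.aestronglyMeasurable (μ := Measure.map (xi θ₀) _)).comp_aemeasurable
        ((h.xi_continuousOn.mono Ioo_subset_Icc_self).aemeasurable measurableSet_Ioo)
  · filter_upwards [h.ae_stringMeasure_iff.1 huu'] with x hx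
    rw [hx]

theorem liouville_mul_comp_xi_ae_eq (u : ℝ → ℂ) :
    liouville θ₀ (fun x => (θ₀ x : ℂ) * u (xi θ₀ x))
      =ᵐ[stringMeasure (stringLength θ₀) (stringWeight θ₀)] u := by
  refine h.ae_stringMeasure_iff.2 ?_
  filter_upwards [ae_restrict_mem measurableSet_Ioo] with x hx
  have hp := h.pos x (Ioo_subset_Ioc_self hx)
  rw [h.liouville_xi _ (Ioo_subset_Icc_self hx), mul_div_cancel_left₀]
  exact Complex.ofReal_ne_zero.2 hp.ne'

/-- The transform `v ↦ v / θ₀` is unitary from `L²(0, 1)` onto `L²_r(0, a)`. -/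
theorem exists_unitary :
    ∃ U : L2 ≃ₗᵢ[ℂ] L2r (stringLength θ₀) (stringWeight θ₀), ∀ v : L2,
      (U v : ℝ → ℂ) =ᵐ[stringMeasure (stringLength θ₀) (stringWeight θ₀)] liouville θ₀ v := by
  let T : L2 →ₗᵢ[ℂ] L2r (stringLength θ₀) (stringWeight θ₀) :=
    { toFun := fun v => (h.memLp_liouville (Lp.memLp v)).toLp _
      map_add' := fun v w => by
        rw [← MemLp.toLp_add]
        refine MemLp.toLp_congr _ _ ((h.liouville_ae_congr (Lp.coeFn_add v w)).trans ?_)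
        exact Eventually.of_forall fun s => by simp [liouville, add_div]
      map_smul' := fun c v => by
        rw [RingHom.id_apply, ← MemLp.toLp_const_smul]
        refine MemLp.toLp_congr _ _ ((h.liouville_ae_congr (Lp.coeFn_smul c v)).trans ?_)
        exact Eventually.of_forall fun s => by simp [liouville, mul_div_assoc]
      norm_map' := fun v => by
        change ‖(h.memLp_liouville (Lp.memLp v)).toLp _‖ = ‖v‖
        rw [Lp.norm_toLp, Lp.norm_def, h.eLpNorm_stringMeasure,
          eLpNorm_congr_ae (h.mul_liouville_ae_eq v)] }
  have hT : ∀ v : L2, (T v : ℝ → ℂ)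
      =ᵐ[stringMeasure (stringLength θ₀) (stringWeight θ₀)] liouville θ₀ v :=
    fun v => (h.memLp_liouville (Lp.memLp v)).coeFn_toLp
  refine ⟨LinearIsometryEquiv.ofSurjective T fun u => ?_, hT⟩
  refine ⟨(h.memLp_mul_comp_xi (Lp.memLp u)).toLp _, Lp.ext ((hT _).trans ?_)⟩
  exact (h.liouville_ae_congr (MemLp.coeFn_toLp _)).trans (h.liouville_mul_comp_xi_ae_eq u)

end IsLiouvilleWeight

/-! ### Transformation of the differential equation -/

/-- A real function that is differentiable as a complex-valued function is differentiable. -/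
theorem hasDerivWithinAt_of_ofReal {I : Set ℝ} {f : ℝ → ℝ} {x : ℝ}
    (hf : DifferentiableWithinAt ℝ (fun x => (f x : ℂ)) I x) :
    HasDerivWithinAt f (derivWithin f I x) I x := by
  have : DifferentiableWithinAt ℝ f I x :=
    (Complex.reCLM.hasFDerivAt.comp_hasDerivWithinAt x hf.hasDerivWithinAt).differentiableWithinAt
  exact this.hasDerivWithinAt

/-- The pull-back `x ↦ θ₀(x) y(ξ(x))` of a function on the string. -/
noncomputable def pullback (θ₀ : ℝ → ℝ) (y : ℝ → ℂ) (x : ℝ) : ℂ := θ₀ x * y (xi θ₀ x)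

section Transform

variable {θ₀ : ℝ → ℝ} {V g k y : ℝ → ℂ}

namespace IsLiouvilleWeight

theorem ofReal_ne_zero (h : IsLiouvilleWeight θ₀) {x : ℝ} (hx : x ∈ Ioc (0 : ℝ) 1) :
    (θ₀ x : ℂ) ≠ 0 :=
  Complex.ofReal_ne_zero.2 (h.pos x hx).ne'

/-- `d/dξ (g / θ₀) = W(θ₀, g)`. -/
theorem hasDerivWithinAt_liouville (h : IsLiouvilleWeight θ₀)
    (hu : DifferentiableOn ℝ (fun x => (θ₀ x : ℂ)) (Ioc 0 1))
    (hg : DifferentiableOn ℝ g (Ioc 0 1)) {s : ℝ} (hs : s ∈ Ioc 0 (stringLength θ₀)) :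
    HasDerivWithinAt (liouville θ₀ g) (wronskian (fun x => (θ₀ x : ℂ)) g (xiInv θ₀ s))
      (Ioc 0 (stringLength θ₀)) s := by
  have hx := h.xiInv_mem_Ioc hs
  have hne := h.ofReal_ne_zero hx
  have hq := (hg _ hx).hasDerivWithinAt.div (hu _ hx).hasDerivWithinAt hne
  refine (hq.scomp s (h.xiInv_hasDerivWithinAt hs) fun t ht => h.xiInv_mem_Ioc ht).congr_deriv ?_
  rw [Complex.real_smul, wronskian]
  push_cast
  field_simp

theorem isACWithDeriv_wronskian
    (hu : HasSecondDeriv (Ioc 0 1) (fun x => (θ₀ x : ℂ)) (fun x => V x * θ₀ x))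
    (hg : HasSecondDeriv (Ioc 0 1) g (fun x => V x * g x - k x)) :
    IsACWithDeriv (Ioc 0 1) (wronskian (fun x => (θ₀ x : ℂ)) g) (fun x => -(θ₀ x * k x)) :=
  (hu.lagrange ordConnected_Ioc hg).congr_deriv ordConnected_Ioc fun x _ => by ring

/-- A solution of `-g'' + V g = k` on `(0, 1]` is turned by the transform into a solution of
`-y'' = r k̃` that extends to `ξ = 0`, its value and derivative there being the limits of `g / θ₀`
and of the Wronskian `W(θ₀, g)`. -/
theorem hasSecondDeriv_liouville (h : IsLiouvilleWeight θ₀)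
    (hu : HasSecondDeriv (Ioc 0 1) (fun x => (θ₀ x : ℂ)) (fun x => V x * θ₀ x))
    (hg : HasSecondDeriv (Ioc 0 1) g (fun x => V x * g x - k x))
    (hk : IntegrableOn (fun x => (θ₀ x : ℂ) * k x) (Ioc 0 1)) :
    ∃ C w₀ : ℂ, Tendsto (fun x => g x / θ₀ x) (𝓝[>] 0) (𝓝 C) ∧
      Tendsto (wronskian (fun x => (θ₀ x : ℂ)) g) (𝓝[>] 0) (𝓝 w₀) ∧
      HasSecondDeriv (Icc 0 (stringLength θ₀)) (Function.update (liouville θ₀ g) 0 C)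
        (fun s => -((stringWeight θ₀ s : ℂ) * liouville θ₀ k s)) ∧
      derivWithin (Function.update (liouville θ₀ g) 0 C) (Icc 0 (stringLength θ₀)) 0 = w₀ ∧
      derivWithin (Function.update (liouville θ₀ g) 0 C) (Icc 0 (stringLength θ₀))
        (stringLength θ₀) = wronskian (fun x => (θ₀ x : ℂ)) g 1 := by
  have ha := h.stringLength_pos
  set W := fun s => wronskian (fun x => (θ₀ x : ℂ)) g (xiInv θ₀ s) with hW
  have hW1 : IsACWithDeriv (Ioc 0 (stringLength θ₀)) W
      (fun s => -((stringWeight θ₀ s : ℂ) * liouville θ₀ k s)) := by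
    refine ((isACWithDeriv_wronskian hu hg).comp ordConnected_Ioc (fun s hs => h.xiInv_mem_Ioc hs)
      (h.xiInv_strictMonoOn.mono Ioc_subset_Icc_self)
      (fun s hs => h.xiInv_hasDerivWithinAt hs) fun s _ => sq_nonneg _).congr_deriv
      ordConnected_Ioc fun s hs => ?_
    have := h.ofReal_ne_zero (h.xiInv_mem_Ioc hs)
    simp only [stringWeight, liouville]
    push_cast
    field_simp
  have hint : IntegrableOn (fun s => -((stringWeight θ₀ s : ℂ) * liouville θ₀ k s))
      (Ioc 0 (stringLength θ₀)) := by
    refine h.integrableOn_comp_iff.2 (hk.neg.congr_fun (fun x hx => ?_) measurableSet_Ioc)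
    have := h.ofReal_ne_zero hx
    simp only [h.stringWeight_xi (Ioc_subset_Icc_self hx), Pi.neg_apply,
      h.liouville_xi k (Ioc_subset_Icc_self hx)]
    push_cast
    field_simp
  obtain ⟨w₀, hw₀, hW2⟩ := hW1.exists_extension ha hint
  have hWc := hW2.continuousOn ordConnected_Icc
  have hy1 : IsACWithDeriv (Ioc 0 (stringLength θ₀)) (liouville θ₀ g) (Function.update W 0 w₀) :=
    .of_hasDerivWithinAt ordConnected_Ioc (fun s hs => by
      rw [Function.update_of_ne hs.1.ne']
      exact h.hasDerivWithinAt_liouville hu.1 hg.1 hs) (hWc.mono Ioc_subset_Icc_self)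
  obtain ⟨C, hC, hy2⟩ := hy1.exists_extension ha
    (hWc.integrableOn_Icc.mono_set Ioc_subset_Icc_self)
  have hd := fun s hs => hy2.hasDerivWithinAt hWc (x := s) hs
  have hun := uniqueDiffOn_Icc ha
  refine ⟨C, w₀, ?_, ?_, .of_hasDerivWithinAt hun hd hW2, ?_, ?_⟩
  · refine (hC.comp h.tendsto_xi).congr' ?_
    filter_upwards [Ioc_mem_nhdsGT (zero_lt_one' ℝ)] with x hx
    exact h.liouville_xi g (Ioc_subset_Icc_self hx)
  · refine (hw₀.comp h.tendsto_xi).congr' ?_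
    filter_upwards [Ioc_mem_nhdsGT (zero_lt_one' ℝ)] with x hx
    simp only [hW, Function.comp_apply, h.xiInv_xi (Ioc_subset_Icc_self hx)]
  · rw [(hd 0 (left_mem_Icc.2 ha.le)).derivWithin (hun 0 (left_mem_Icc.2 ha.le)),
      Function.update_self]
  · rw [(hd _ (right_mem_Icc.2 ha.le)).derivWithin (hun _ (right_mem_Icc.2 ha.le)),
      Function.update_of_ne ha.ne']
    simp only [hW, h.xiInv_stringLength]

theorem hasDerivWithinAt_comp_xi (h : IsLiouvilleWeight θ₀)
    (hy : DifferentiableOn ℝ y (Icc 0 (stringLength θ₀))) {x : ℝ} (hx : x ∈ Ioc (0 : ℝ) 1) :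
    HasDerivWithinAt (fun t => y (xi θ₀ t))
      (derivWithin y (Icc 0 (stringLength θ₀)) (xi θ₀ x) / θ₀ x ^ 2) (Ioc 0 1) x := by
  have hs := h.xi_mem_Ioc hx
  refine ((hy _ (Ioc_subset_Icc_self hs)).hasDerivWithinAt.scomp x (h.xi_hasDerivWithinAt hx)
    fun t ht => Ioc_subset_Icc_self (h.xi_mem_Ioc ht)).congr_deriv ?_
  rw [Complex.real_smul]
  push_cast
  ring

/-- `W(θ₀, θ₀ y) = dy/dξ`. -/
theorem wronskian_pullback (h : IsLiouvilleWeight θ₀)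
    (hu : DifferentiableOn ℝ (fun x => (θ₀ x : ℂ)) (Ioc 0 1))
    (hy : DifferentiableOn ℝ y (Icc 0 (stringLength θ₀))) {x : ℝ} (hx : x ∈ Ioc (0 : ℝ) 1) :
    wronskian (fun x => (θ₀ x : ℂ)) (pullback θ₀ y) x =
      derivWithin y (Icc 0 (stringLength θ₀)) (xi θ₀ x) := by
  have hne := h.ofReal_ne_zero hx
  have hd := ((hu x hx).hasDerivWithinAt.mul (h.hasDerivWithinAt_comp_xi hy hx)).derivWithin
    (uniqueDiffOn_Ioc (0 : ℝ) 1 x hx)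
  have hd' : derivWithin (pullback θ₀ y) (Ioc 0 1) x = _ := hd
  rw [wronskian, hd', pullback]
  field_simp
  ring

/-- A solution of `-y'' = r k` on `[0, a]` is pulled back to a solution of `-g'' + V g = θ₀ k`. -/
theorem hasSecondDeriv_pullback (h : IsLiouvilleWeight θ₀)
    (hu : HasSecondDeriv (Ioc 0 1) (fun x => (θ₀ x : ℂ)) (fun x => V x * θ₀ x))
    (hy : HasSecondDeriv (Icc 0 (stringLength θ₀)) y
      (fun s => -((stringWeight θ₀ s : ℂ) * k s))) :
    HasSecondDeriv (Ioc 0 1) (pullback θ₀ y)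
      (fun x => V x * pullback θ₀ y x - pullback θ₀ k x) := by
  have hoc : (Ioc (0 : ℝ) 1).OrdConnected := ordConnected_Ioc
  have hY := fun x hx => h.hasDerivWithinAt_comp_xi hy.1 (x := x) hx
  set Y' := fun x => derivWithin y (Icc 0 (stringLength θ₀)) (xi θ₀ x) with hY'
  have hmaps : MapsTo (xi θ₀) (Ioc 0 1) (Icc 0 (stringLength θ₀)) := fun x hx =>
    Ioc_subset_Icc_self (h.xi_mem_Ioc hx)
  have hY'ac : IsACWithDeriv (Ioc 0 1) Y' (fun x => -((θ₀ x : ℂ) ^ 2 * k (xi θ₀ x))) := by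
    refine (hy.2.comp hoc hmaps (h.xi_strictMonoOn.mono Ioc_subset_Icc_self)
      (fun x hx => h.xi_hasDerivWithinAt hx)
      fun x _ => one_div_nonneg.2 (sq_nonneg _)).congr_deriv hoc fun x hx => ?_
    have := h.ofReal_ne_zero hx
    simp only [h.stringWeight_xi (Ioc_subset_Icc_self hx)]
    push_cast
    field_simp
  have huc : ContinuousOn (fun x => (θ₀ x : ℂ)) (Ioc 0 1) := hu.1.continuousOn
  have hYac : IsACWithDeriv (Ioc 0 1) (fun x => y (xi θ₀ x)) (fun x => Y' x / θ₀ x ^ 2) :=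
    .of_hasDerivWithinAt hoc hY ((hY'ac.continuousOn hoc).div (huc.pow 2) fun x hx =>
      pow_ne_zero 2 (h.ofReal_ne_zero hx))
  have hinv : IsACWithDeriv (Ioc 0 1) (fun x => (θ₀ x : ℂ)⁻¹)
      (fun x => -derivWithin (fun x => (θ₀ x : ℂ)) (Ioc 0 1) x / (θ₀ x : ℂ) ^ 2) :=
    .of_hasDerivWithinAt hoc (fun x hx => (hu.hasDerivWithinAt hx).inv (h.ofReal_ne_zero hx))
      ((hu.continuousOn_derivWithin hoc).neg.div (huc.pow 2) fun x hx =>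
        pow_ne_zero 2 (h.ofReal_ne_zero hx))
  -- The derivative of `θ₀ · (y ∘ ξ)` is `θ₀' · (y ∘ ξ) + (y' ∘ ξ) / θ₀`.
  refine .of_hasDerivWithinAt (uniqueDiffOn_Ioc (0 : ℝ) 1)
    (g' := fun x => derivWithin (fun x => (θ₀ x : ℂ)) (Ioc 0 1) x * y (xi θ₀ x) +
      Y' x * (θ₀ x : ℂ)⁻¹) (fun x hx => ?_) ?_
  · refine ((hu.hasDerivWithinAt hx).mul (hY x hx)).congr_deriv ?_
    have := h.ofReal_ne_zero hx
    simp only [hY']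
    field_simp
  · refine ((hu.2.mul hoc hYac).add (hY'ac.mul hoc hinv)).congr_deriv hoc fun x hx => ?_
    have := h.ofReal_ne_zero hx
    simp only [Pi.add_apply, pullback]
    field_simp
    ring

/-! ### Boundary conditions -/

/-- The Wronskian with a second solution `t` expressed by the Wronskians with `θ₀`. -/
theorem wronskian_eq (h : IsLiouvilleWeight θ₀) (g t : ℝ → ℂ) {x : ℝ} (hx : x ∈ Ioc (0 : ℝ) 1) :
    wronskian g t x = g x / θ₀ x * wronskian (fun x => (θ₀ x : ℂ)) t x -
      t x / θ₀ x * wronskian (fun x => (θ₀ x : ℂ)) g x := by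
  have := h.ofReal_ne_zero hx
  simp only [wronskian]
  field_simp
  ring

theorem tendsto_wronskian (h : IsLiouvilleWeight θ₀) {t : ℝ → ℂ} {C w₀ : ℂ}
    (ht : Tendsto (fun x => t x / θ₀ x) (𝓝[>] 0) (𝓝 1))
    (hWt : Tendsto (wronskian (fun x => (θ₀ x : ℂ)) t) (𝓝[>] 0) (𝓝 0))
    (hg : Tendsto (fun x => g x / θ₀ x) (𝓝[>] 0) (𝓝 C))
    (hw : Tendsto (wronskian (fun x => (θ₀ x : ℂ)) g) (𝓝[>] 0) (𝓝 w₀)) :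
    Tendsto (wronskian g t) (𝓝[>] 0) (𝓝 (-w₀)) := by
  have := (hg.mul hWt).sub (ht.mul hw)
  rw [mul_zero, one_mul, zero_sub] at this
  refine this.congr' ?_
  filter_upwards [Ioc_mem_nhdsGT (zero_lt_one' ℝ)] with x hx
  exact (h.wronskian_eq g t hx).symm

/-- The boundary conditions at `x = 1` and `ξ = a` agree up to a non-zero factor depending only
on the boundary parameters. -/
theorem exists_boundary_factor (h : IsLiouvilleWeight θ₀)
    (hu : DifferentiableOn ℝ (fun x => (θ₀ x : ℂ)) (Ioc 0 1)) {β β' : ℝ}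
    (hβ : β ∈ Ico 0 Real.pi) (hβ' : β' ∈ Ico 0 Real.pi) (hrel : AnglesRelated θ₀ β β') :
    ∃ κ : ℂ, κ ≠ 0 ∧ ∀ g : ℝ → ℂ,
      (Real.cos β' : ℂ) * (g 1 / θ₀ 1) -
        (Real.sin β' : ℂ) * wronskian (fun x => (θ₀ x : ℂ)) g 1 =
      κ * ((Real.cos β : ℂ) * g 1 - (Real.sin β : ℂ) * derivWithin g (Ioc 0 1) 1) := by
  have h1 : (1 : ℝ) ∈ Ioc (0 : ℝ) 1 := right_mem_Ioc.2 zero_lt_one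
  have hne := h.ofReal_ne_zero h1
  rcases hrel with ⟨rfl, rfl⟩ | ⟨hb, hb', hcot⟩
  · refine ⟨(θ₀ 1 : ℂ)⁻¹, inv_ne_zero hne, fun g => ?_⟩
    simp
    ring
  · have hs := Real.sin_pos_of_pos_of_lt_pi (hβ.1.lt_of_ne (Ne.symm hb)) hβ.2
    have hs' := Real.sin_pos_of_pos_of_lt_pi (hβ'.1.lt_of_ne (Ne.symm hb')) hβ'.2
    have hsC : (Real.sin β : ℂ) ≠ 0 := Complex.ofReal_ne_zero.2 hs.ne'
    have hsC' : (Real.sin β' : ℂ) ≠ 0 := Complex.ofReal_ne_zero.2 hs'.ne'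
    refine ⟨θ₀ 1 * Real.sin β' / Real.sin β, div_ne_zero (mul_ne_zero hne hsC') hsC, fun g => ?_⟩
    have hderiv : derivWithin (fun x => (θ₀ x : ℂ)) (Ioc 0 1) 1 =
        ((derivWithin θ₀ (Ioc 0 1) 1 : ℝ) : ℂ) :=
      (hasDerivWithinAt_of_ofReal (hu 1 h1)).ofReal_comp.derivWithin
        (uniqueDiffOn_Ioc (0 : ℝ) 1 1 h1)
    rw [Real.cot_eq_cos_div_sin, Real.cot_eq_cos_div_sin] at hcot
    have hcos : Real.cos β' = Real.sin β' * (θ₀ 1 * (θ₀ 1 * (Real.cos β / Real.sin β) -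
        derivWithin θ₀ (Ioc 0 1) 1)) := by
      rw [← hcot]; field_simp
    rw [hcos, wronskian, hderiv]
    push_cast at hsC hsC' ⊢
    field_simp
    ring

end IsLiouvilleWeight

end Transform

/-! ### Leading behaviour at the singular endpoint -/

/-- A function continuous on `(0, 1]` is integrable as soon as it is dominated by an integrable
function near `0`. -/
theorem integrableOn_of_eventually_norm_le {E : Type*} [NormedAddCommGroup E] {f : ℝ → E}
    {G : ℝ → ℝ} {c : ℝ} (hc : 0 < c) (hf : ContinuousOn f (Ioc 0 1))
    (hG : IntegrableOn G (Ioc 0 c)) (hle : ∀ᶠ x in 𝓝[>] 0, ‖f x‖ ≤ G x) :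
    IntegrableOn f (Ioc 0 1) := by
  obtain ⟨δ, hδ, hδs⟩ := mem_nhdsGT_iff_exists_Ioc_subset.1 (hle : {x | ‖f x‖ ≤ G x} ∈ 𝓝[>] (0 : ℝ))
  obtain ⟨d, hd0, hd⟩ : ∃ d, 0 < d ∧ d ≤ min (min δ c) 1 := ⟨_, by
    simp only [lt_min_iff]; exact ⟨⟨hδ, hc⟩, one_pos⟩, le_rfl⟩
  simp only [le_min_iff] at hd
  obtain ⟨⟨hd1, hd2⟩, hd3⟩ := hd
  have h1 : IntegrableOn f (Ioc 0 d) := by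
    refine (hG.mono_set (Ioc_subset_Ioc_right hd2)).mono'
      ((hf.mono (Ioc_subset_Ioc_right hd3)).aestronglyMeasurable measurableSet_Ioc) ?_
    filter_upwards [ae_restrict_mem measurableSet_Ioc] with x hx
    exact hδs ⟨hx.1, hx.2.trans hd1⟩
  have h2 : IntegrableOn f (Icc d 1) :=
    (hf.mono fun x hx => ⟨hd0.trans_le hx.1, hx.2⟩).integrableOn_Icc
  refine (h1.union h2).mono_set fun x hx => ?_
  rcases le_total x d with h | h
  · exact Or.inl ⟨hx.1, h⟩
  · exact Or.inr ⟨h, hx.2⟩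

theorem HasLeadingFactor.tendsto_div {p : ℝ → ℝ} {y : ℝ → ℂ} (hp : ∀ x ∈ Ioo (0 : ℝ) 1, 0 < p x)
    (hy : HasLeadingFactor p y) : Tendsto (fun x => y x / p x) (𝓝[>] 0) (𝓝 1) := by
  obtain ⟨c, hc0, hc1, t, w, ht, ht0, hyt⟩ := hy
  have h := ((ht.continuousOn ordConnected_Icc) 0 (left_mem_Icc.2 hc0.le)).mono
    Ioc_subset_Icc_self
  have h' : Tendsto t (𝓝[>] 0) (𝓝 1) := by
    rw [← ht0, ← nhdsWithin_Ioc_eq_nhdsGT hc0]; exact h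
  refine h'.congr' ?_
  filter_upwards [Ioc_mem_nhdsGT hc0] with x hx
  have : (p x : ℂ) ≠ 0 :=
    Complex.ofReal_ne_zero.2 (hp x ⟨hx.1, hx.2.trans_lt hc1⟩).ne'
  rw [hyt x hx, mul_div_cancel_left₀ _ this]

section SingularFactor

variable {l : ℝ}

theorem singularFactor_pos (hl : -1 / 2 ≤ l) {x : ℝ} (hx : x ∈ Ioo (0 : ℝ) 1) :
    0 < singularFactor l x := by
  unfold singularFactor
  split_ifs with h
  · have := Real.log_neg hx.1 hx.2
    have := Real.sqrt_pos.2 hx.1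
    nlinarith
  · have : -1 / 2 < l := lt_of_le_of_ne hl (Ne.symm h)
    exact div_pos (Real.rpow_pos_of_pos hx.1 _) (by linarith)

/-- The quotient of the leading behaviours of the principal and the non-principal solution. -/
noncomputable def leadingRatio (l x : ℝ) : ℝ := x ^ (l + 1) / singularFactor l x

theorem leadingRatio_of_eq (hl : l = -1 / 2) {x : ℝ} (hx : 0 < x) :
    leadingRatio l x = -(Real.log x)⁻¹ := by
  have hs := (Real.sqrt_pos.2 hx).ne'
  have he : x ^ (l + 1) = Real.sqrt x := by rw [Real.sqrt_eq_rpow, hl]; norm_num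
  rw [leadingRatio, singularFactor, if_pos hl, he, div_neg, div_mul_cancel_left₀ hs]

theorem leadingRatio_of_ne (hl : l ≠ -1 / 2) {x : ℝ} (hx : 0 < x) :
    leadingRatio l x = (2 * l + 1) * x ^ (2 * l + 1) := by
  have hne : 2 * l + 1 ≠ 0 := fun h => hl (by linarith)
  rw [leadingRatio, singularFactor, if_neg hl, Real.rpow_neg hx.le,
    show 2 * l + 1 = (l + 1) + l by ring, Real.rpow_add hx (l + 1) l]
  have := (Real.rpow_pos_of_pos hx l).ne'
  have h2 : l + 1 + l ≠ 0 := by convert hne using 1; ring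
  field_simp

/-- The quotient of the leading behaviours is a primitive of `1 / singularFactor²`, as reduction of
order predicts. -/
theorem hasDerivAt_leadingRatio {x : ℝ} (hx : x ∈ Ioo (0 : ℝ) 1) :
    HasDerivAt (leadingRatio l) (1 / singularFactor l x ^ 2) x := by
  by_cases h : l = -1 / 2
  · have hlog := (Real.log_neg hx.1 hx.2).ne
    refine (((Real.hasDerivAt_log hx.1.ne').inv hlog).neg.congr_deriv ?_).congr_of_eventuallyEq ?_
    · rw [singularFactor, if_pos h, neg_sq, mul_pow, Real.sq_sqrt hx.1.le]
      have := hx.1.ne'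
      field_simp
    · filter_upwards [Ioi_mem_nhds hx.1] with t ht
      exact leadingRatio_of_eq h ht
  · have hne : 2 * l + 1 ≠ 0 := fun h' => h (by linarith)
    refine (((Real.hasDerivAt_rpow_const (p := 2 * l + 1) (Or.inl hx.1.ne')).const_mul
      (2 * l + 1)).congr_deriv ?_).congr_of_eventuallyEq ?_
    · have := (Real.rpow_pos_of_pos hx.1 l).ne'
      rw [singularFactor, if_neg h, Real.rpow_neg hx.1.le,
        show 2 * l + 1 - 1 = l + l by ring, Real.rpow_add hx.1]
      field_simp
    · filter_upwards [Ioi_mem_nhds hx.1] with t ht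
      exact leadingRatio_of_ne h ht

theorem tendsto_leadingRatio (hl : -1 / 2 ≤ l) : Tendsto (leadingRatio l) (𝓝[>] 0) (𝓝 0) := by
  by_cases h : l = -1 / 2
  · have := (tendsto_inv_atBot_zero.comp Real.tendsto_log_nhdsGT_zero).neg
    rw [neg_zero] at this
    refine this.congr' ?_
    filter_upwards [self_mem_nhdsWithin] with x hx
    exact (leadingRatio_of_eq h hx).symm
  · have hpos : 0 < 2 * l + 1 := by
      have : -1 / 2 < l := lt_of_le_of_ne hl (Ne.symm h)
      linarith
    have hc := (((Real.continuousAt_rpow_const 0 (2 * l + 1) (Or.inr hpos.le)).tendsto.const_mul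
      (2 * l + 1)).mono_left nhdsWithin_le_nhds : Tendsto _ (𝓝[>] (0 : ℝ)) _)
    rw [Real.zero_rpow hpos.ne', mul_zero] at hc
    refine hc.congr' ?_
    filter_upwards [self_mem_nhdsWithin] with x hx
    exact (leadingRatio_of_ne h hx).symm

theorem integrableOn_inv_singularFactor_sq (hl : -1 / 2 ≤ l) :
    IntegrableOn (fun x => 1 / singularFactor l x ^ 2) (Ioc 0 (1 / 2)) := by
  have hd : ∀ x ∈ Ioo (0 : ℝ) 1, HasDerivAt (Function.update (leadingRatio l) 0 0)
      (1 / singularFactor l x ^ 2) x := fun x hx =>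
    (hasDerivAt_leadingRatio hx).congr_of_eventuallyEq <| by
      filter_upwards [Ioi_mem_nhds hx.1] with t ht
      exact Function.update_of_ne (ne_of_gt ht) _ _
  refine intervalIntegral.integrableOn_deriv_of_nonneg (g := Function.update (leadingRatio l) 0 0)
    (fun x hx => ?_) (fun x hx => hd x ⟨hx.1, hx.2.trans (by norm_num)⟩)
    fun x _ => one_div_nonneg.2 (sq_nonneg _)
  rcases hx.1.eq_or_lt with rfl | h0
  · rw [continuousWithinAt_update_same]
    refine (tendsto_leadingRatio hl).mono_left (nhdsWithin_mono _ ?_)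
    exact fun t ht => ht.1.1.lt_of_ne (Ne.symm ht.2)
  · exact (hd x ⟨h0, hx.2.trans_lt (by norm_num)⟩).continuousAt.continuousWithinAt

/-- The non-principal solution is square integrable near `0` because `l < 1/2`. -/
theorem integrableOn_singularFactor_sq (hl' : l < 1 / 2) :
    IntegrableOn (fun x => singularFactor l x ^ 2) (Ioc 0 1) := by
  by_cases h : l = -1 / 2
  · have hc : Continuous fun x : ℝ => 4 * (Real.sqrt x * Real.log (Real.sqrt x)) ^ 2 :=
      continuous_const.mul ((Real.continuous_mul_log.comp Real.continuous_sqrt).pow 2)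
    refine (hc.integrableOn_Icc.mono_set Ioc_subset_Icc_self).congr_fun (fun x hx => ?_)
      measurableSet_Ioc
    simp only [singularFactor, if_pos h, Real.log_sqrt hx.1.le]
    ring
  · have hi : IntegrableOn (fun x : ℝ => x ^ (-2 * l)) (Ioc 0 1) :=
      (intervalIntegrable_iff_integrableOn_Ioc_of_le zero_le_one).1
        (intervalIntegral.intervalIntegrable_rpow' (by linarith))
    refine IntegrableOn.congr_fun (hi.const_mul (1 / (2 * l + 1) ^ 2)) (fun x hx => ?_)
      measurableSet_Ioc
    simp only [singularFactor, if_neg h]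
    rw [show -2 * l = -l + -l by ring, Real.rpow_add hx.1]
    field_simp

end SingularFactor

section LeadingWeight

variable {l : ℝ} {θ₀ : ℝ → ℝ} {y : ℝ → ℂ}

theorem eventually_ratio_bounds (hl : -1 / 2 ≤ l)
    (hlead : Tendsto (fun x => θ₀ x / singularFactor l x) (𝓝[>] 0) (𝓝 1)) :
    ∀ᶠ x in 𝓝[>] 0, 0 < singularFactor l x ∧ singularFactor l x / 2 ≤ θ₀ x ∧
      θ₀ x ≤ 2 * singularFactor l x := by
  filter_upwards [hlead.eventually (Ioo_mem_nhds (by norm_num : (1 / 2 : ℝ) < 1) one_lt_two),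
    Ioo_mem_nhdsGT (zero_lt_one' ℝ)] with x hx hx1
  have hp := singularFactor_pos hl hx1
  have h1 := (lt_div_iff₀ hp).1 hx.1
  have h2 := (div_lt_iff₀ hp).1 hx.2
  exact ⟨hp, by linarith, by linarith⟩

theorem isLiouvilleWeight_of_leading (hl : -1 / 2 ≤ l) (hpos : ∀ x ∈ Ioc (0 : ℝ) 1, 0 < θ₀ x)
    (hcont : ContinuousOn θ₀ (Ioc 0 1))
    (hlead : Tendsto (fun x => θ₀ x / singularFactor l x) (𝓝[>] 0) (𝓝 1)) :
    IsLiouvilleWeight θ₀ := by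
  refine ⟨hpos, hcont, ?_⟩
  refine (integrableOn_of_eventually_norm_le (f := fun x => 1 / θ₀ x ^ 2) (c := 1 / 2) (by norm_num)
    (continuousOn_const.div (hcont.pow 2) fun x hx => (pow_pos (hpos x hx) 2).ne')
    ((integrableOn_inv_singularFactor_sq hl).const_mul 4) ?_).mono_set Ioo_subset_Ioc_self
  filter_upwards [eventually_ratio_bounds hl hlead] with x ⟨hp, h1, _⟩
  have h0 : 0 < θ₀ x := by linarith
  rw [Real.norm_of_nonneg (by positivity), mul_one_div, div_le_div_iff₀ (by positivity)
    (by positivity)]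
  nlinarith

theorem integrableOn_sq_of_leading (hl : -1 / 2 ≤ l) (hl' : l < 1 / 2)
    (hcont : ContinuousOn θ₀ (Ioc 0 1))
    (hlead : Tendsto (fun x => θ₀ x / singularFactor l x) (𝓝[>] 0) (𝓝 1)) :
    IntegrableOn (fun x => θ₀ x ^ 2) (Ioc 0 1) := by
  refine integrableOn_of_eventually_norm_le one_pos (hcont.pow 2)
    ((integrableOn_singularFactor_sq hl').const_mul 4) ?_
  filter_upwards [eventually_ratio_bounds hl hlead] with x ⟨hp, h1, h2⟩
  have h0 : 0 < θ₀ x := by linarith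
  rw [Real.norm_of_nonneg (by positivity)]
  nlinarith

theorem IsLiouvilleWeight.integrableOn_mul (h : IsLiouvilleWeight θ₀)
    (h2 : IntegrableOn (fun x => θ₀ x ^ 2) (Ioc 0 1)) (hy : ContinuousOn y (Ioc 0 1)) {C : ℂ}
    (hC : Tendsto (fun x => y x / θ₀ x) (𝓝[>] 0) (𝓝 C)) :
    IntegrableOn (fun x => (θ₀ x : ℂ) * y x) (Ioc 0 1) := by
  refine integrableOn_of_eventually_norm_le one_pos
    ((Complex.continuous_ofReal.comp_continuousOn h.continuousOn).mul hy)
    (h2.const_mul (‖C‖ + 1)) ?_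
  filter_upwards [hC.norm.eventually (Iio_mem_nhds (lt_add_one ‖C‖)),
    Ioc_mem_nhdsGT (zero_lt_one' ℝ)] with x hx hxm
  have hp := h.pos x hxm
  rw [norm_div, Complex.norm_real, Real.norm_of_nonneg hp.le, div_lt_iff₀ hp] at hx
  rw [norm_mul, Complex.norm_real, Real.norm_of_nonneg hp.le]
  nlinarith

/-- `ξ(x)` has the same leading behaviour at `0` as the quotient of the solutions. -/
theorem IsLiouvilleWeight.tendsto_leadingRatio_div_xi (h : IsLiouvilleWeight θ₀)
    (hl : -1 / 2 ≤ l) (hlead : Tendsto (fun x => θ₀ x / singularFactor l x) (𝓝[>] 0) (𝓝 1)) :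
    Tendsto (fun x => leadingRatio l x / xi θ₀ x) (𝓝[>] 0) (𝓝 1) := by
  have hI : Ioo (0 : ℝ) 1 ∈ 𝓝[>] (0 : ℝ) := Ioo_mem_nhdsGT zero_lt_one
  refine HasDerivAt.lhopital_zero_nhdsGT
    (mem_of_superset hI fun x hx => hasDerivAt_leadingRatio hx)
    (g' := fun x => 1 / θ₀ x ^ 2)
    (mem_of_superset hI fun x hx =>
      (h.xi_hasDerivWithinAt (Ioo_subset_Ioc_self hx)).hasDerivAt (Ioc_mem_nhds hx.1 hx.2))
    (mem_of_superset hI fun x hx =>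
      (one_div_pos.2 (pow_pos (h.pos x (Ioo_subset_Ioc_self hx)) 2)).ne')
    (tendsto_leadingRatio hl) (h.tendsto_xi.mono_right nhdsWithin_le_nhds) ?_
  have := hlead.pow 2
  rw [one_pow] at this
  refine this.congr' ?_
  filter_upwards [hI] with x hx
  have h1 := (h.pos x (Ioo_subset_Ioc_self hx)).ne'
  have h2 := (singularFactor_pos hl hx).ne'
  field_simp

/-- The principal solution divided by `θ₀` behaves like `ξ` at `0`. -/
theorem IsLiouvilleWeight.tendsto_principal_div_xi (h : IsLiouvilleWeight θ₀)
    (hl : -1 / 2 ≤ l) (hlead : Tendsto (fun x => θ₀ x / singularFactor l x) (𝓝[>] 0) (𝓝 1))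
    (hy : HasLeadingFactor (fun x => x ^ (l + 1)) y) :
    Tendsto (fun x => y x / θ₀ x / xi θ₀ x) (𝓝[>] 0) (𝓝 1) := by
  have h1 := hy.tendsto_div fun x hx => Real.rpow_pos_of_pos hx.1 _
  have h2 := (hlead.inv₀ one_ne_zero).mul (h.tendsto_leadingRatio_div_xi hl hlead)
  rw [inv_one, one_mul] at h2
  have h3 := h1.mul ((Complex.continuous_ofReal.tendsto 1).comp h2)
  rw [Complex.ofReal_one, one_mul] at h3
  refine h3.congr' ?_
  filter_upwards [Ioo_mem_nhdsGT (zero_lt_one' ℝ)] with x hx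
  have e1 : (x ^ (l + 1) : ℝ) ≠ 0 := (Real.rpow_pos_of_pos hx.1 _).ne'
  have e2 := (h.pos x (Ioo_subset_Ioc_self hx)).ne'
  have e3 := (singularFactor_pos hl hx).ne'
  have e4 := (h.xi_mem_Ioc (Ioo_subset_Ioc_self hx)).1.ne'
  have e1' := Complex.ofReal_ne_zero.2 e1
  have e2' := Complex.ofReal_ne_zero.2 e2
  have e3' := Complex.ofReal_ne_zero.2 e3
  have e4' := Complex.ofReal_ne_zero.2 e4
  simp only [Function.comp_apply, leadingRatio, Complex.ofReal_mul, Complex.ofReal_div,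
    Complex.ofReal_inv]
  field_simp

end LeadingWeight

/-! ### Positivity of the solution at energy zero -/

theorem inner_eq_integral_of_ofReal {f g : ℝ → ℝ} {F G : L2}
    (hF : (F : ℝ → ℂ) =ᵐ[volume.restrict (Ioo (0 : ℝ) 1)] fun x => (f x : ℂ))
    (hG : (G : ℝ → ℂ) =ᵐ[volume.restrict (Ioo (0 : ℝ) 1)] fun x => (g x : ℂ)) :
    inner ℂ F G = ((∫ x in Ioo (0 : ℝ) 1, f x * g x : ℝ) : ℂ) := by
  rw [L2.inner_def, ← integral_complex_ofReal]
  refine integral_congr_ae ?_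
  filter_upwards [hF, hG] with x h1 h2
  rw [h1, h2]
  simp [mul_comm]

theorem memLp_two_of_eventually_norm_le {f : ℝ → ℂ} {G : ℝ → ℝ} (hf : ContinuousOn f (Ioc 0 1))
    (hG : IntegrableOn G (Ioc 0 1)) (hle : ∀ᶠ x in 𝓝[>] 0, ‖f x‖ ^ 2 ≤ G x) :
    MemLp f 2 (volume.restrict (Ioo (0 : ℝ) 1)) := by
  refine (memLp_two_iff_integrable_sq_norm ((hf.mono
    Ioo_subset_Ioc_self).aestronglyMeasurable measurableSet_Ioo)).2 ?_
  have : IntegrableOn (fun x => ‖f x‖ ^ 2) (Ioc 0 1) :=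
    integrableOn_of_eventually_norm_le one_pos (hf.norm.pow 2) hG
      (hle.mono fun x hx => by rwa [Real.norm_of_nonneg (sq_nonneg _)])
  exact this.mono_set Ioo_subset_Ioc_self

section Positivity

variable {l : ℝ} {q : ℝ → ℝ} {t : ℝ → ℂ} {β ε : ℝ} {θ₀ : ℝ → ℝ}

/-- Testing `H ≥ ε` with `θ₀ γ`, where `γ` is a twice continuously differentiable cut-off equal to
`1` near `0` and vanishing to first order at `1`: since `τ θ₀ = 0`, the energy of `θ₀ γ` is
`∫ θ₀² γ'²`. -/
theorem BoundedBelowBy.integral_le (hH : BoundedBelowBy (besselOp l q t β) ε)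
    (hu : HasSecondDeriv (Ioc 0 1) (fun x => (θ₀ x : ℂ))
      (fun x => (besselPotential l q x : ℂ) * θ₀ x))
    (hWt : Tendsto (wronskian (fun x => (θ₀ x : ℂ)) t) (𝓝[>] 0) (𝓝 0))
    (h2 : IntegrableOn (fun x => θ₀ x ^ 2) (Ioc 0 1))
    {γ γ₁ γ₂ : ℝ → ℝ} (hγ : ∀ x, HasDerivAt γ (γ₁ x) x) (hγ₁ : ∀ x, HasDerivAt γ₁ (γ₂ x) x)
    (hγ₂ : Continuous γ₂) {c : ℝ} (hc : 0 < c) (hc1 : c ≤ 1) (hγc : ∀ x ≤ c, γ x = 1)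
    (hγ1 : γ 1 = 0) (hγ₁1 : γ₁ 1 = 0) :
    ε * ∫ x in Ioo (0 : ℝ) 1, (θ₀ x * γ x) ^ 2 ≤ ∫ x in c..1, θ₀ x ^ 2 * γ₁ x ^ 2 := by
  have hoc : (Ioc (0 : ℝ) 1).OrdConnected := ordConnected_Ioc
  have h11 : (1 : ℝ) ∈ Ioc (0 : ℝ) 1 := right_mem_Ioc.2 one_pos
  set u' := fun x => derivWithin θ₀ (Ioc 0 1) x with hu'
  have hd : ∀ x ∈ Ioc (0 : ℝ) 1, HasDerivWithinAt θ₀ (u' x) (Ioc 0 1) x := fun x hx =>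
    hasDerivWithinAt_of_ofReal (hu.1 x hx)
  have hdC : ∀ x ∈ Ioc (0 : ℝ) 1,
      derivWithin (fun x => (θ₀ x : ℂ)) (Ioc 0 1) x = (u' x : ℂ) := fun x hx =>
    (hd x hx).ofReal_comp.derivWithin (uniqueDiffOn_Ioc (0 : ℝ) 1 x hx)
  have huc : ContinuousOn θ₀ (Ioc 0 1) := fun x hx => (hd x hx).continuousWithinAt
  have hu'c : ContinuousOn u' (Ioc 0 1) :=
    (Complex.continuous_re.comp_continuousOn (hu.continuousOn_derivWithin hoc)).congr fun x hx => by
      simp [hdC x hx]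
  have hγcont : Continuous γ := continuous_iff_continuousAt.2 fun x => (hγ x).continuousAt
  have hγ₁cont : Continuous γ₁ := continuous_iff_continuousAt.2 fun x => (hγ₁ x).continuousAt
  have hγ₁c : ∀ x ≤ c, γ₁ x = 0 := fun x hx => by
    have h1 := (hγ x).hasDerivWithinAt (s := Iic c)
    have h2 : HasDerivWithinAt γ 0 (Iic c) x :=
      (hasDerivWithinAt_const x (Iic c) (1 : ℝ)).congr (fun y hy => hγc y hy) (hγc x hx)
    exact (uniqueDiffOn_Iic c x hx).eq_deriv _ h1 h2
  have hγ₂c : ∀ x ≤ c, γ₂ x = 0 := fun x hx => by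
    have h1 := (hγ₁ x).hasDerivWithinAt (s := Iic c)
    have h2 : HasDerivWithinAt γ₁ 0 (Iic c) x :=
      (hasDerivWithinAt_const x (Iic c) (0 : ℝ)).congr (fun y hy => hγ₁c y hy) (hγ₁c x hx)
    exact (uniqueDiffOn_Iic c x hx).eq_deriv _ h1 h2
  -- The test function `θ₀ γ` and its image `τ (θ₀ γ) = -2 θ₀' γ' - θ₀ γ''`.
  set f : ℝ → ℝ := fun x => θ₀ x * γ x with hf
  set k : ℝ → ℝ := fun x => -2 * (u' x * γ₁ x) - θ₀ x * γ₂ x with hk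
  have hfd : ∀ x ∈ Ioc (0 : ℝ) 1, HasDerivWithinAt (fun x => (f x : ℂ))
      ((u' x : ℂ) * γ x + θ₀ x * γ₁ x) (Ioc 0 1) x := fun x hx => by
    refine ((hd x hx).mul (hγ x).hasDerivWithinAt).ofReal_comp.congr_deriv ?_
    push_cast; ring
  have hγC : IsACWithDeriv (Ioc 0 1) (fun x => (γ x : ℂ)) (fun x => (γ₁ x : ℂ)) :=
    .of_hasDerivWithinAt hoc (fun x _ => (hγ x).hasDerivWithinAt.ofReal_comp)
      (Complex.continuous_ofReal.comp hγ₁cont).continuousOn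
  have hγ₁C : IsACWithDeriv (Ioc 0 1) (fun x => (γ₁ x : ℂ)) (fun x => (γ₂ x : ℂ)) :=
    .of_hasDerivWithinAt hoc (fun x _ => (hγ₁ x).hasDerivWithinAt.ofReal_comp)
      (Complex.continuous_ofReal.comp hγ₂).continuousOn
  have hu'ac := hu.2.congr_left hdC
  have huac := (hu.isACWithDeriv hoc).congr_deriv hoc hdC
  have hf2 : HasSecondDeriv (Ioc 0 1) (fun x => (f x : ℂ))
      (fun x => (besselPotential l q x : ℂ) * f x - k x) := by
    refine .of_hasDerivWithinAt (uniqueDiffOn_Ioc (0 : ℝ) 1) hfd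
      (((hu'ac.mul hoc hγC).add (huac.mul hoc hγ₁C)).congr_deriv hoc fun x hx => ?_)
    simp only [hf, hk, Pi.add_apply]
    push_cast
    ring
  have hfc : ContinuousOn f (Ioc 0 1) := huc.mul hγcont.continuousOn
  have hkc : ContinuousOn k (Ioc 0 1) :=
    (continuousOn_const.mul (hu'c.mul hγ₁cont.continuousOn)).sub (huc.mul hγ₂.continuousOn)
  have hnear : Ioc 0 c ∈ 𝓝[>] (0 : ℝ) := Ioc_mem_nhdsGT hc
  have hfL : MemLp (fun x => (f x : ℂ)) 2 (volume.restrict (Ioo (0 : ℝ) 1)) := by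
    refine memLp_two_of_eventually_norm_le (Complex.continuous_ofReal.comp_continuousOn hfc) h2 ?_
    filter_upwards [hnear] with x hx
    rw [Complex.norm_real, Real.norm_eq_abs, sq_abs, hf]
    simp only [hγc x hx.2, mul_one, le_refl]
  have hkL : MemLp (fun x => (k x : ℂ)) 2 (volume.restrict (Ioo (0 : ℝ) 1)) := by
    refine memLp_two_of_eventually_norm_le (Complex.continuous_ofReal.comp_continuousOn hkc)
      (G := 0) (integrableOn_zero) ?_
    filter_upwards [hnear] with x hx
    simp [hk, hγ₁c x hx.2, hγ₂c x hx.2]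
  have hmem : (hfL.toLp _, hkL.toLp _) ∈ (besselOp l q t β).graph := by
    rw [besselOp_graph]
    refine ⟨_, _, hfL.coeFn_toLp, hkL.coeFn_toLp, hf2, ?_, ?_⟩
    · refine hWt.congr' ?_
      filter_upwards [hnear] with x hx
      have hx1 : x ∈ Ioc (0 : ℝ) 1 := ⟨hx.1, hx.2.trans hc1⟩
      rw [wronskian, wronskian, (hfd x hx1).derivWithin (uniqueDiffOn_Ioc (0 : ℝ) 1 x hx1),
        hdC x hx1, hγ₁c x hx.2, hγc x hx.2]
      simp [hf, hγc x hx.2]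
    · rw [BCOne, (hfd 1 h11).derivWithin (uniqueDiffOn_Ioc (0 : ℝ) 1 1 h11), hγ₁1, hγ1]
      simp [hf, hγ1]
  obtain ⟨F, hF1, hF2⟩ := (LinearPMap.mem_graph_iff _).1 hmem
  simp only at hF1 hF2
  have hbound := hH F
  have hn : ‖(F : L2)‖ ^ 2 = ∫ x in Ioo (0 : ℝ) 1, f x ^ 2 := by
    have := inner_self_eq_norm_sq (𝕜 := ℂ) (F : L2)
    rw [hF1, inner_eq_integral_of_ofReal hfL.coeFn_toLp hfL.coeFn_toLp] at this
    rw [hF1, ← this]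
    simp [sq]
  rw [hn, hF2, hF1, inner_eq_integral_of_ofReal hfL.coeFn_toLp hkL.coeFn_toLp,
    Complex.ofReal_re] at hbound
  refine hbound.trans_eq ?_
  have hsub : Icc c 1 ⊆ Ioc (0 : ℝ) 1 := Icc_subset_Ioc hc le_rfl
  have hstep : ∫ x in Ioo (0 : ℝ) 1, f x * k x = ∫ x in c..1, f x * k x := by
    rw [← integral_Ioc_eq_integral_Ioo, intervalIntegral.integral_of_le hc1]
    refine setIntegral_eq_of_subset_of_forall_sdiff_eq_zero measurableSet_Ioc
      (Ioc_subset_Ioc_left hc.le) fun x hx => ?_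
    have hxc : x ≤ c := by
      by_contra hlt
      exact hx.2 ⟨not_le.1 hlt, hx.1.2⟩
    simp [hk, hγ₁c x hxc, hγ₂c x hxc]
  rw [hstep]
  -- Integration by parts: `(θ₀ γ) τ(θ₀ γ) = θ₀² γ'² - (θ₀² γ γ')'`.
  have hA : ContinuousOn (fun x => θ₀ x ^ 2 * γ₁ x ^ 2) (uIcc c 1) := by
    rw [uIcc_of_le hc1]
    exact ((huc.mono hsub).pow 2).mul (hγ₁cont.continuousOn.pow 2)
  have hB : ContinuousOn (fun x => f x * k x) (uIcc c 1) := by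
    rw [uIcc_of_le hc1]
    exact (hfc.mono hsub).mul (hkc.mono hsub)
  have hparts := intervalIntegral.integral_eq_sub_of_hasDerivAt_of_le hc1
    (f := fun x => θ₀ x ^ 2 * (γ x * γ₁ x))
    (f' := fun x => θ₀ x ^ 2 * γ₁ x ^ 2 - f x * k x)
    (((huc.mono hsub).pow 2).mul (hγcont.mul hγ₁cont).continuousOn) (fun x hx => ?_)
    (hA.intervalIntegrable.sub hB.intervalIntegrable)
  · rw [intervalIntegral.integral_sub hA.intervalIntegrable hB.intervalIntegrable, hγ1,
      hγ₁c c le_rfl] at hparts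
    linarith
  · have hx1 : x ∈ Ioc (0 : ℝ) 1 := ⟨hc.trans hx.1, hx.2.le⟩
    have hux := (hd x hx1).hasDerivAt (Ioc_mem_nhds hx1.1 hx.2)
    refine ((hux.pow 2).mul ((hγ x).mul (hγ₁ x))).congr_deriv ?_
    simp only [hf, hk, Pi.mul_apply, Pi.pow_apply]
    push_cast
    ring

/-- If `H ≥ ε > 0`, a solution of `τ θ₀ = 0` satisfying the boundary condition at `0` has no zeros.
At a zero `x₀` it would be `O(x₀ - x)`, so that cutting it off between `x₀ - 2δ` and `x₀ - δ` costs
the energy `O(δ)` only. -/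
theorem BoundedBelowBy.ne_zero (hε : 0 < ε) (hH : BoundedBelowBy (besselOp l q t β) ε)
    (hu : HasSecondDeriv (Ioc 0 1) (fun x => (θ₀ x : ℂ))
      (fun x => (besselPotential l q x : ℂ) * θ₀ x))
    (hWt : Tendsto (wronskian (fun x => (θ₀ x : ℂ)) t) (𝓝[>] 0) (𝓝 0))
    (h2 : IntegrableOn (fun x => θ₀ x ^ 2) (Ioc 0 1))
    (hpos : ∀ᶠ x in 𝓝[>] 0, 0 < θ₀ x) {x₀ : ℝ} (hx₀ : x₀ ∈ Ioc (0 : ℝ) 1) : θ₀ x₀ ≠ 0 := by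
  intro hz
  have hoc : (Ioc (0 : ℝ) 1).OrdConnected := ordConnected_Ioc
  have hd : ∀ x ∈ Ioc (0 : ℝ) 1, HasDerivWithinAt θ₀ (derivWithin θ₀ (Ioc 0 1) x) (Ioc 0 1) x :=
    fun x hx => hasDerivWithinAt_of_ofReal (hu.1 x hx)
  have huc : ContinuousOn θ₀ (Ioc 0 1) := fun x hx => (hd x hx).continuousWithinAt
  have hu'c : ContinuousOn (derivWithin θ₀ (Ioc 0 1)) (Ioc 0 1) :=
    (Complex.continuous_re.comp_continuousOn (hu.continuousOn_derivWithin hoc)).congr fun x hx => by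
      rw [Function.comp_apply, (hd x hx).ofReal_comp.derivWithin (uniqueDiffOn_Ioc (0 : ℝ) 1 x hx),
        Complex.ofReal_re]
  have hhalf : 0 < x₀ / 2 := half_pos hx₀.1
  have hsub : Icc (x₀ / 2) x₀ ⊆ Ioc 0 1 := fun x hx => ⟨hhalf.trans_le hx.1, hx.2.trans hx₀.2⟩
  obtain ⟨C, hC⟩ := isCompact_Icc.exists_bound_of_continuousOn (hu'c.mono hsub)
  have hC0 : 0 ≤ C := (norm_nonneg _).trans (hC x₀ (right_mem_Icc.2 (half_le_self hx₀.1.le)))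
  have hlip : ∀ x ∈ Icc (x₀ / 2) x₀, |θ₀ x| ≤ C * (x₀ - x) := fun x hx => by
    have := (convex_Icc (x₀ / 2) x₀).norm_image_sub_le_of_norm_hasDerivWithin_le
      (fun y hy => (hd y (hsub hy)).mono hsub) hC (right_mem_Icc.2 (half_le_self hx₀.1.le)) hx
    rw [hz, sub_zero, Real.norm_eq_abs, Real.norm_eq_abs, abs_sub_comm,
      abs_of_nonneg (sub_nonneg.2 hx.2)] at this
    exact this
  have hS : ContDiff ℝ 2 Real.smoothTransition := Real.smoothTransition.contDiff
  have hS1 : ContDiff ℝ 1 (deriv Real.smoothTransition) := hS.deriv'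
  have hSd : ∀ x, HasDerivAt Real.smoothTransition (deriv Real.smoothTransition x) x := fun x =>
    (hS.differentiable two_ne_zero x).hasDerivAt
  have hS1d : ∀ x, HasDerivAt (deriv Real.smoothTransition)
      (deriv (deriv Real.smoothTransition) x) x := fun x =>
    (hS1.differentiable one_ne_zero x).hasDerivAt
  have hS0 : ∀ x < 0, deriv Real.smoothTransition x = 0 := fun x hx => by
    have : Real.smoothTransition =ᶠ[𝓝 x] fun _ => 0 := by
      filter_upwards [Iio_mem_nhds hx] with y hy
      exact Real.smoothTransition.zero_of_nonpos (le_of_lt hy)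
    rw [this.deriv_eq, deriv_const]
  obtain ⟨K, hK⟩ := (isCompact_Icc (a := (-1 : ℝ)) (b := 1)).exists_bound_of_continuousOn
    hS1.continuous.continuousOn
  -- A fixed interval on which the test functions coincide with `θ₀`.
  obtain ⟨d, hd0, hdpos⟩ :=
    mem_nhdsGT_iff_exists_Ioc_subset.1 (hpos : {x | 0 < θ₀ x} ∈ 𝓝[>] (0 : ℝ))
  set b := min d (x₀ / 2) with hb
  have hb0 : 0 < b := lt_min hd0 hhalf
  have hbx : b ≤ x₀ / 2 := min_le_right _ _
  have hb1 : b ≤ 1 := hbx.trans ((half_le_self hx₀.1.le).trans hx₀.2)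
  set m := ∫ x in (b / 2)..b, θ₀ x ^ 2 with hm
  have hint : IntervalIntegrable (fun x => θ₀ x ^ 2) volume (b / 2) b :=
    (intervalIntegrable_iff_integrableOn_Ioc_of_le (by linarith)).2
      (h2.mono_set (Ioc_subset_Ioc (by linarith) hb1))
  have hm0 : 0 < m := intervalIntegral.intervalIntegral_pos_of_pos_on hint (fun x hx =>
    pow_pos (hdpos ⟨by linarith [hx.1], hx.2.le.trans (min_le_left _ _)⟩) 2) (by linarith)
  have key : ∀ δ, 0 < δ → δ ≤ x₀ / 4 → ε * m ≤ 8 * C ^ 2 * K ^ 2 * δ := by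
    intro δ hδ hδx
    set τ := fun x : ℝ => (x₀ - x) / δ - 1 with hτ
    have hτd : ∀ x, HasDerivAt τ (-1 / δ) x := fun x =>
      (((hasDerivAt_id x).const_sub x₀).div_const δ).sub_const 1
    have hγ : ∀ x, HasDerivAt (fun x => Real.smoothTransition (τ x))
        (deriv Real.smoothTransition (τ x) * (-1 / δ)) x := fun x => (hSd (τ x)).comp x (hτd x)
    have hγ₁ : ∀ x, HasDerivAt (fun x => deriv Real.smoothTransition (τ x) * (-1 / δ))
        (deriv (deriv Real.smoothTransition) (τ x) * (-1 / δ) * (-1 / δ)) x := fun x =>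
      ((hS1d (τ x)).comp x (hτd x)).mul_const _
    have hτc : Continuous τ := continuous_iff_continuousAt.2 fun x => (hτd x).continuousAt
    have hγ₂ : Continuous fun x =>
        deriv (deriv Real.smoothTransition) (τ x) * (-1 / δ) * (-1 / δ) :=
      (((hS1.continuous_deriv le_rfl).comp hτc).mul_const _).mul_const _
    have hτneg : ∀ x, x₀ ≤ x → τ x < 0 := fun x hx => by
      have : (x₀ - x) / δ ≤ 0 := div_nonpos_of_nonpos_of_nonneg (by linarith) hδ.le
      simp only [hτ]; linarith
    have hτone : ∀ x ≤ x₀ - 2 * δ, Real.smoothTransition (τ x) = 1 := fun x hx => by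
      refine Real.smoothTransition.one_of_one_le ?_
      have : 2 ≤ (x₀ - x) / δ := (le_div_iff₀ hδ).2 (by linarith)
      simp only [hτ]; linarith
    have hen := hH.integral_le hu hWt h2 hγ hγ₁ hγ₂ (c := x₀ - 2 * δ) (by linarith)
      (by linarith [hx₀.2]) hτone (Real.smoothTransition.zero_of_nonpos (hτneg 1 hx₀.2).le)
      (by rw [hS0 _ (hτneg 1 hx₀.2), zero_mul])
    have hlow : m ≤ ∫ x in Ioo (0 : ℝ) 1, (θ₀ x * Real.smoothTransition (τ x)) ^ 2 := by
      rw [hm, intervalIntegral.integral_of_le (by linarith), ← integral_Ioc_eq_integral_Ioo]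
      have hcut : IntegrableOn (fun x => (θ₀ x * Real.smoothTransition (τ x)) ^ 2) (Ioc 0 1) := by
        refine h2.mono' (((huc.mul (hS.continuous.comp hτc).continuousOn).pow 2
          ).aestronglyMeasurable measurableSet_Ioc) (Eventually.of_forall fun x => ?_)
        rw [Real.norm_of_nonneg (sq_nonneg _), mul_pow]
        exact mul_le_of_le_one_right (sq_nonneg _)
          (pow_le_one₀ (Real.smoothTransition.nonneg _) (Real.smoothTransition.le_one _))
      refine le_of_eq_of_le (setIntegral_congr_fun measurableSet_Ioc fun x hx => ?_)
        (setIntegral_mono_set hcut (Eventually.of_forall fun x => sq_nonneg _)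
          (Ioc_subset_Ioc (by linarith) hb1).eventuallyLE)
      simp only [hτone x (by linarith [hx.2]), mul_one]
    have hup : ∫ x in (x₀ - 2 * δ)..1, θ₀ x ^ 2 *
        (deriv Real.smoothTransition (τ x) * (-1 / δ)) ^ 2 ≤ 8 * C ^ 2 * K ^ 2 * δ := by
      have hcont : ContinuousOn (fun x => θ₀ x ^ 2 *
          (deriv Real.smoothTransition (τ x) * (-1 / δ)) ^ 2) (Ioc 0 1) :=
        (huc.pow 2).mul (((hS1.continuous.comp hτc).mul_const _).pow 2).continuousOn
      have hi : ∀ x ∈ Ioc (0 : ℝ) 1, ∀ y ∈ Ioc (0 : ℝ) 1, IntervalIntegrable (fun x => θ₀ x ^ 2 *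
          (deriv Real.smoothTransition (τ x) * (-1 / δ)) ^ 2) volume x y := fun x hx y hy =>
        (hcont.mono (hoc.uIcc_subset hx hy)).intervalIntegrable
      have hcm : x₀ - 2 * δ ∈ Ioc (0 : ℝ) 1 := ⟨by linarith, by linarith [hx₀.2]⟩
      rw [← intervalIntegral.integral_add_adjacent_intervals (hi _ hcm _ hx₀)
        (hi _ hx₀ 1 (right_mem_Ioc.2 one_pos))]
      have hz2 : ∫ x in x₀..1, θ₀ x ^ 2 *
          (deriv Real.smoothTransition (τ x) * (-1 / δ)) ^ 2 = 0 := by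
        rw [intervalIntegral.integral_congr (g := fun _ => (0 : ℝ)) fun x hx => ?_]
        · simp
        · rw [uIcc_of_le hx₀.2] at hx
          simp [hS0 _ (hτneg x hx.1)]
      rw [hz2, add_zero]
      have := intervalIntegral.norm_integral_le_of_norm_le_const (a := x₀ - 2 * δ) (b := x₀)
        (C := 4 * C ^ 2 * K ^ 2) (f := fun x => θ₀ x ^ 2 *
          (deriv Real.smoothTransition (τ x) * (-1 / δ)) ^ 2) fun x hx => ?_
      · rw [sub_sub_cancel, abs_of_pos (by linarith : (0 : ℝ) < 2 * δ)] at this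
        refine (le_abs_self _).trans (this.trans_eq ?_)
        ring
      · rw [uIoc_of_le (by linarith)] at hx
        have h1 := hlip x ⟨by linarith [hx.1], hx.2⟩
        have h1' : |θ₀ x| ≤ C * (2 * δ) :=
          h1.trans (mul_le_mul_of_nonneg_left (by linarith [hx.1]) hC0)
        have h2' : θ₀ x ^ 2 ≤ (C * (2 * δ)) ^ 2 := sq_le_sq' (by linarith [neg_abs_le (θ₀ x)])
          ((le_abs_self _).trans h1')
        have hτm : τ x ∈ Icc (-1 : ℝ) 1 := by
          have e1 : 0 ≤ (x₀ - x) / δ := div_nonneg (by linarith [hx.2]) hδ.le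
          have e2 : (x₀ - x) / δ ≤ 2 := (div_le_iff₀ hδ).2 (by linarith [hx.1])
          simp only [hτ]
          exact ⟨by linarith, by linarith⟩
        have h3 := hK _ hτm
        rw [Real.norm_eq_abs] at h3
        have h3' : deriv Real.smoothTransition (τ x) ^ 2 ≤ K ^ 2 :=
          sq_le_sq' (by linarith [neg_abs_le (deriv Real.smoothTransition (τ x))])
            ((le_abs_self _).trans h3)
        rw [Real.norm_of_nonneg (by positivity), mul_pow, ← mul_assoc]
        calc θ₀ x ^ 2 * deriv Real.smoothTransition (τ x) ^ 2 * (-1 / δ) ^ 2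
            ≤ (C * (2 * δ)) ^ 2 * K ^ 2 * (-1 / δ) ^ 2 := by gcongr
          _ = 4 * C ^ 2 * K ^ 2 := by field_simp; ring
    exact (mul_le_mul_of_nonneg_left hlow hε.le).trans (hen.trans hup)
  have hlim : Tendsto (fun δ : ℝ => 8 * C ^ 2 * K ^ 2 * δ) (𝓝[>] 0) (𝓝 0) := by
    have : Tendsto (fun δ : ℝ => 8 * C ^ 2 * K ^ 2 * δ) (𝓝 0) (𝓝 (8 * C ^ 2 * K ^ 2 * 0)) :=
      tendsto_id.const_mul _
    rw [mul_zero] at this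
    exact this.mono_left nhdsWithin_le_nhds
  have := ge_of_tendsto hlim (mem_of_superset (Ioc_mem_nhdsGT (by linarith [hx₀.1] : 0 < x₀ / 4))
    fun δ hδ => key δ hδ.1 hδ.2)
  exact absurd this (not_le.2 (mul_pos hε hm0))

end Positivity

/-- A continuous function on `(0, 1]` without zeros that is positive near `0` is positive. -/
theorem pos_of_ne_zero {f : ℝ → ℝ} (hf : ContinuousOn f (Ioc 0 1))
    (hne : ∀ x ∈ Ioc (0 : ℝ) 1, f x ≠ 0) (hpos : ∀ᶠ x in 𝓝[>] 0, 0 < f x) {x : ℝ}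
    (hx : x ∈ Ioc (0 : ℝ) 1) : 0 < f x := by
  by_contra hle
  obtain ⟨y, hy, hyx⟩ := (hpos.and (Ioo_mem_nhdsGT hx.1)).exists
  have hsub : Icc y x ⊆ Ioc 0 1 := Icc_subset_Ioc hyx.1 hx.2
  obtain ⟨s, hs, hs0⟩ := intermediate_value_Icc' hyx.2.le (hf.mono hsub) ⟨not_lt.1 hle, hy.le⟩
  exact hne s (hsub hs) hs0

/-! ### Solutions of the string equation -/

section StringEquation

variable {a : ℝ} {r : ℝ → ℝ} {z : ℂ} {c s d y : ℝ → ℂ}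

theorem string_wronskian_const (ha : 0 ≤ a)
    (hc : HasSecondDeriv (Icc 0 a) c (fun ξ => -(z * r ξ * c ξ)))
    (hs : HasSecondDeriv (Icc 0 a) s (fun ξ => -(z * r ξ * s ξ))) {x : ℝ} (hx : x ∈ Icc 0 a) :
    c x * derivWithin s (Icc 0 a) x - derivWithin c (Icc 0 a) x * s x =
      c 0 * derivWithin s (Icc 0 a) 0 - derivWithin c (Icc 0 a) 0 * s 0 := by
  have h := ((hc.lagrange ordConnected_Icc hs).congr_deriv ordConnected_Icc
    (v := fun _ => 0) fun t _ => by ring) 0 (left_mem_Icc.2 ha) x hx hx.1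
  rw [intervalIntegral.integral_zero] at h
  exact sub_eq_zero.1 h.2

/-- Every solution is a combination of the fundamental solutions; this follows from the constancy
of Wronskians. -/
theorem string_solution_eq (ha : 0 ≤ a)
    (hc : HasSecondDeriv (Icc 0 a) c (fun ξ => -(z * r ξ * c ξ)))
    (hs : HasSecondDeriv (Icc 0 a) s (fun ξ => -(z * r ξ * s ξ)))
    (hd : HasSecondDeriv (Icc 0 a) d (fun ξ => -(z * r ξ * d ξ)))
    (hc0 : c 0 = 1) (hc1 : derivWithin c (Icc 0 a) 0 = 0)
    (hs0 : s 0 = 0) (hs1 : derivWithin s (Icc 0 a) 0 = 1) {x : ℝ} (hx : x ∈ Icc 0 a) :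
    d x = d 0 * c x + derivWithin d (Icc 0 a) 0 * s x := by
  have h1 := string_wronskian_const ha hc hs hx
  have h2 := string_wronskian_const ha hd hs hx
  have h3 := string_wronskian_const ha hd hc hx
  rw [hc0, hc1, hs0, hs1] at h1
  rw [hs0, hs1] at h2
  rw [hc0, hc1] at h3
  linear_combination -d x * h1 + c x * h2 - s x * h3

/-- A non-zero solution satisfying real boundary conditions at both endpoints exists for real
spectral parameter only. -/
theorem im_eq_zero_of_BCString (ha : 0 < a) (hr : ∀ ξ ∈ Ioo 0 a, 0 < r ξ)
    (hy : HasSecondDeriv (Icc 0 a) y (fun ξ => -(z * r ξ * y ξ))) (hy0 : y 0 = 1)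
    (hy1 : derivWithin y (Icc 0 a) 0 = 0) {β : ℝ} (hβ : BCString a β y) : z.im = 0 := by
  by_contra hz
  have hun := uniqueDiffOn_Icc ha
  have h0 := left_mem_Icc.2 ha.le
  have h1 := right_mem_Icc.2 ha.le
  have hcd : ∀ x ∈ Icc 0 a, derivWithin (fun x => (starRingEnd ℂ) (y x)) (Icc 0 a) x =
      (starRingEnd ℂ) (derivWithin y (Icc 0 a) x) := fun x hx =>
    ((Complex.conjCLE : ℂ →L[ℝ] ℂ).hasFDerivAt.comp_hasDerivWithinAt _
      (hy.hasDerivWithinAt hx)).derivWithin (hun x hx)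
  have h := ((hy.lagrange ordConnected_Icc (hy.conj hun)).congr_deriv ordConnected_Icc
    (v := fun x => (2 * z.im * Complex.I) * ((r x * ‖y x‖ ^ 2 : ℝ) : ℂ)) fun x _ => by
      have e1 : y x * (starRingEnd ℂ) (y x) = ((‖y x‖ ^ 2 : ℝ) : ℂ) := by
        rw [Complex.mul_conj, Complex.normSq_eq_norm_sq]
      have e2 : z - (starRingEnd ℂ) z = 2 * z.im * Complex.I := by
        rw [Complex.sub_conj]; push_cast; ring
      simp only [map_neg, map_mul, Complex.conj_ofReal]
      push_cast at e1 ⊢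
      rw [← e1, ← e2]
      ring) 0 h0 a h1 ha.le
  have hint : IntervalIntegrable (fun x => r x * ‖y x‖ ^ 2) volume 0 a := by
    have hc : (2 * z.im * Complex.I : ℂ) ≠ 0 := by
      simp [hz, Complex.I_ne_zero]
    have h' := h.1.const_mul (2 * z.im * Complex.I : ℂ)⁻¹
    have h'' : IntervalIntegrable (fun x => ((r x * ‖y x‖ ^ 2 : ℝ) : ℂ)) volume 0 a := by
      refine h'.congr fun x _ => ?_
      simp only [inv_mul_cancel_left₀ hc]
    rw [intervalIntegrable_iff] at h'' ⊢
    exact h''.re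
  -- The Wronskian of `y` and its conjugate vanishes at both endpoints.
  have hWa : y a * (starRingEnd ℂ) (derivWithin y (Icc 0 a) a) -
      derivWithin y (Icc 0 a) a * (starRingEnd ℂ) (y a) = 0 := by
    unfold BCString at hβ
    have hβ' := congrArg (starRingEnd ℂ) hβ
    simp only [map_sub, map_mul, Complex.conj_ofReal, map_zero] at hβ'
    have htrig : (Real.cos β : ℂ) ^ 2 + (Real.sin β : ℂ) ^ 2 = 1 := by
      exact_mod_cast Real.cos_sq_add_sin_sq β
    linear_combination (-(y a * (starRingEnd ℂ) (derivWithin y (Icc 0 a) a) -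
      derivWithin y (Icc 0 a) a * (starRingEnd ℂ) (y a))) * htrig +
      (Real.cos β * (starRingEnd ℂ) (derivWithin y (Icc 0 a) a) +
        Real.sin β * (starRingEnd ℂ) (y a)) * hβ -
      (Real.cos β * derivWithin y (Icc 0 a) a + Real.sin β * y a) * hβ'
  have h2 := h.2
  simp only [hcd a h1, hcd 0 h0, hWa, hy1, map_zero, mul_zero, zero_mul, sub_zero,
    intervalIntegral.integral_const_mul] at h2
  rw [intervalIntegral.integral_ofReal] at h2
  have hI : ∫ x in (0 : ℝ)..a, r x * ‖y x‖ ^ 2 = 0 := by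
    have := (mul_eq_zero.1 h2.symm).resolve_left (by simp [hz, Complex.I_ne_zero])
    exact_mod_cast this
  rw [intervalIntegral.integral_of_le ha.le, integral_Ioc_eq_integral_Ioo,
    setIntegral_eq_zero_iff_of_nonneg_ae] at hI
  · have hae : y =ᵐ[volume.restrict (Icc 0 a)] 0 := by
      rw [← restrict_Ioo_eq_restrict_Icc]
      filter_upwards [hI, ae_restrict_mem measurableSet_Ioo] with x hx hxm
      have := (mul_eq_zero.1 hx).resolve_left (hr x hxm).ne'
      simpa using this
    have := Measure.eqOn_Icc_of_ae_eq volume ha.ne hae hy.1.continuousOn continuousOn_const h0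
    rw [hy0] at this
    exact one_ne_zero this
  · filter_upwards [ae_restrict_mem measurableSet_Ioo] with x hx
    exact mul_nonneg (hr x hx).le (sq_nonneg _)
  · rw [intervalIntegrable_iff_integrableOn_Ioo_of_le ha.le] at hint
    exact hint

theorem BCString_sub_mul_iff (ha : 0 < a) {β : ℝ} (hs : DifferentiableOn ℝ s (Icc 0 a))
    (hc : DifferentiableOn ℝ c (Icc 0 a)) (M : ℂ) :
    BCString a β (fun ξ => s ξ - M * c ξ) ↔
      Real.cos β * s a - Real.sin β * derivWithin s (Icc 0 a) a =
        M * (Real.cos β * c a - Real.sin β * derivWithin c (Icc 0 a) a) := by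
  have h1 := right_mem_Icc.2 ha.le
  have hd := ((hs a h1).hasDerivWithinAt.sub ((hc a h1).hasDerivWithinAt.const_mul M)).derivWithin
    (uniqueDiffOn_Icc ha a h1)
  have hd' : derivWithin (fun ξ => s ξ - M * c ξ) (Icc 0 a) a = _ := hd
  rw [BCString, hd', ← sub_eq_zero (b := M * _)]
  constructor <;> intro h <;> linear_combination h

theorem BCOne_sub_mul_iff {β : ℝ} (hs : DifferentiableOn ℝ s (Ioc 0 1))
    (hc : DifferentiableOn ℝ c (Ioc 0 1)) (M : ℂ) :
    BCOne β (fun ξ => s ξ - M * c ξ) ↔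
      Real.cos β * s 1 - Real.sin β * derivWithin s (Ioc 0 1) 1 =
        M * (Real.cos β * c 1 - Real.sin β * derivWithin c (Ioc 0 1) 1) := by
  have h1 : (1 : ℝ) ∈ Ioc (0 : ℝ) 1 := right_mem_Ioc.2 one_pos
  have hd := ((hs 1 h1).hasDerivWithinAt.sub ((hc 1 h1).hasDerivWithinAt.const_mul M)).derivWithin
    (uniqueDiffOn_Ioc (0 : ℝ) 1 1 h1)
  have hd' : derivWithin (fun ξ => s ξ - M * c ξ) (Ioc 0 1) 1 = _ := hd
  rw [BCOne, hd', ← sub_eq_zero (b := M * _)]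
  constructor <;> intro h <;> linear_combination h

end StringEquation

/-! ### Unitary equivalence of the operators -/

section UnitaryEquivalence

variable {θ₀ : ℝ → ℝ} {l : ℝ} {q : ℝ → ℝ} {t : ℝ → ℂ} {β β' : ℝ}

/-- The domain and action of `H` correspond to those of the string operator under any map acting
as the Liouville transform. -/
theorem IsLiouvilleWeight.mem_graph_iff (h : IsLiouvilleWeight θ₀)
    (hu : HasSecondDeriv (Ioc 0 1) (fun x => (θ₀ x : ℂ))
      (fun x => (besselPotential l q x : ℂ) * θ₀ x))
    (h2 : IntegrableOn (fun x => θ₀ x ^ 2) (Ioc 0 1))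
    (ht : Tendsto (fun x => t x / θ₀ x) (𝓝[>] 0) (𝓝 1))
    (hWt : Tendsto (wronskian (fun x => (θ₀ x : ℂ)) t) (𝓝[>] 0) (𝓝 0))
    (hβ : β ∈ Ico 0 Real.pi) (hβ' : β' ∈ Ico 0 Real.pi) (hrel : AnglesRelated θ₀ β β')
    {f k : L2} {F K : L2r (stringLength θ₀) (stringWeight θ₀)}
    (hF : (F : ℝ → ℂ) =ᵐ[stringMeasure (stringLength θ₀) (stringWeight θ₀)] liouville θ₀ f)
    (hK : (K : ℝ → ℂ) =ᵐ[stringMeasure (stringLength θ₀) (stringWeight θ₀)] liouville θ₀ k) :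
    (f, k) ∈ (besselOp l q t β).graph ↔
      (F, K) ∈ (stringOp (stringLength θ₀) (stringWeight θ₀) β').graph := by
  have ha := h.stringLength_pos
  obtain ⟨κ, hκ, hBC⟩ := h.exists_boundary_factor hu.1 hβ hβ' hrel
  rw [besselOp_graph, stringOp_graph β' h.aemeasurable_stringWeight fun s hs =>
    h.stringWeight_pos (Ioo_subset_Ioc_self hs)]
  constructor
  · rintro ⟨g, k', h1, h2', h3, h4, h5⟩
    simp only at h1 h2'
    have huL : MemLp (fun x => (θ₀ x : ℂ)) 2 (volume.restrict (Ioo (0 : ℝ) 1)) :=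
      memLp_two_of_eventually_norm_le hu.1.continuousOn h2
        (Eventually.of_forall fun x => by simp)
    have hint : IntegrableOn (fun x => (θ₀ x : ℂ) * k' x) (Ioc 0 1) := by
      rw [IntegrableOn, ← restrict_Ioo_eq_restrict_Ioc]
      exact huL.integrable_mul ((memLp_congr_ae h2').1 (Lp.memLp k))
    obtain ⟨C, w₀, hC, hw, hY, hY0, hYa⟩ := h.hasSecondDeriv_liouville hu h3 hint
    have hw0 : w₀ = 0 := by
      have := tendsto_nhds_unique (h.tendsto_wronskian ht hWt hC hw) h4
      simpa using this
    refine ⟨_, _, ?_, hK.trans (h.liouville_ae_congr h2'), hY, hY0.trans hw0, ?_⟩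
    · refine hF.trans ((h.liouville_ae_congr h1).trans ?_)
      refine stringMeasure_absolutelyContinuous.ae_le ?_
      filter_upwards [ae_restrict_mem measurableSet_Ioo] with s hs
      exact (Function.update_of_ne hs.1.ne' _ _).symm
    · rw [BCString, hYa, Function.update_of_ne ha.ne', liouville, h.xiInv_stringLength, hBC]
      unfold BCOne at h5
      rw [h5, mul_zero]
  · rintro ⟨y, k', h1, h2', h3, h4, h5⟩
    simp only at h1 h2'
    have hpull : ∀ {p : L2} {P : L2r (stringLength θ₀) (stringWeight θ₀)} {v : ℝ → ℂ},
        (P : ℝ → ℂ) =ᵐ[stringMeasure (stringLength θ₀) (stringWeight θ₀)] liouville θ₀ p →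
        (P : ℝ → ℂ) =ᵐ[stringMeasure (stringLength θ₀) (stringWeight θ₀)] v →
        (p : ℝ → ℂ) =ᵐ[volume.restrict (Ioo (0 : ℝ) 1)] pullback θ₀ v := fun {p P v} hp hv => by
      filter_upwards [h.ae_stringMeasure_iff.1 (hp.symm.trans hv), h.mul_liouville_ae_eq p]
        with x hx hx'
      rw [← hx', hx, pullback]
    have hc := h3.continuousOn_derivWithin ordConnected_Icc
    have hlim : ∀ {v : ℝ → ℂ}, ContinuousOn v (Icc 0 (stringLength θ₀)) →
        Tendsto (fun x => v (xi θ₀ x)) (𝓝[>] 0) (𝓝 (v 0)) := fun {v} hv => by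
      have := (hv 0 (left_mem_Icc.2 ha.le)).mono Ioc_subset_Icc_self
      rw [ContinuousWithinAt, nhdsWithin_Ioc_eq_nhdsGT ha] at this
      exact this.comp h.tendsto_xi
    refine ⟨_, _, hpull hF h1, hpull hK h2', h.hasSecondDeriv_pullback hu h3, ?_, ?_⟩
    · suffices hs : Tendsto (wronskian (pullback θ₀ y) t) (𝓝[>] 0) (𝓝 (-0)) by
        rwa [neg_zero] at hs
      refine h.tendsto_wronskian ht hWt (C := y 0) ?_ ?_
      · refine (hlim h3.1.continuousOn).congr' ?_
        filter_upwards [Ioc_mem_nhdsGT (zero_lt_one' ℝ)] with x hx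
        rw [pullback, mul_div_cancel_left₀ _ (h.ofReal_ne_zero hx)]
      · have := hlim hc
        rw [h4] at this
        refine this.congr' ?_
        filter_upwards [Ioc_mem_nhdsGT (zero_lt_one' ℝ)] with x hx
        exact (h.wronskian_pullback hu.1 h3.1 hx).symm
    · have h11 : (1 : ℝ) ∈ Ioc (0 : ℝ) 1 := right_mem_Ioc.2 one_pos
      have hb := hBC (pullback θ₀ y)
      rw [h.wronskian_pullback hu.1 h3.1 h11, pullback,
        mul_div_cancel_left₀ _ (h.ofReal_ne_zero h11)] at hb
      change Real.cos β' * y (stringLength θ₀) - Real.sin β' *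
        derivWithin y (Icc 0 (stringLength θ₀)) (stringLength θ₀) = _ at hb
      unfold BCString at h5
      rw [h5] at hb
      exact (mul_eq_zero.1 hb.symm).resolve_left hκ

/-! ### Fundamental solutions -/

/-- The transform of a solution of energy `z` solves the string equation with the same `z`. -/
theorem IsLiouvilleWeight.hasSecondDeriv_update_liouville (h : IsLiouvilleWeight θ₀)
    (hu : HasSecondDeriv (Ioc 0 1) (fun x => (θ₀ x : ℂ))
      (fun x => (besselPotential l q x : ℂ) * θ₀ x))
    (h2 : IntegrableOn (fun x => θ₀ x ^ 2) (Ioc 0 1)) {z C : ℂ} {g : ℝ → ℂ}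
    (hg : IsBesselSolution l q z g) (hC : Tendsto (fun x => g x / θ₀ x) (𝓝[>] 0) (𝓝 C)) :
    HasSecondDeriv (Icc 0 (stringLength θ₀)) (Function.update (liouville θ₀ g) 0 C)
        (fun s => -(z * stringWeight θ₀ s * Function.update (liouville θ₀ g) 0 C s)) ∧
      Tendsto (wronskian (fun x => (θ₀ x : ℂ)) g) (𝓝[>] 0)
        (𝓝 (derivWithin (Function.update (liouville θ₀ g) 0 C) (Icc 0 (stringLength θ₀)) 0)) ∧
      derivWithin (Function.update (liouville θ₀ g) 0 C) (Icc 0 (stringLength θ₀))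
        (stringLength θ₀) = wronskian (fun x => (θ₀ x : ℂ)) g 1 := by
  have hint := h.integrableOn_mul h2 hg.1.continuousOn hC
  obtain ⟨C', w₀, hC', hw, hY, hY0, hYa⟩ := h.hasSecondDeriv_liouville hu (k := fun x => z * g x)
    (hg.congr_deriv ordConnected_Ioc fun x _ => by ring)
    (IntegrableOn.congr_fun (hint.const_mul z) (fun x _ => by ring) measurableSet_Ioc)
  obtain rfl := tendsto_nhds_unique hC hC'
  refine ⟨⟨hY.1, hY.2.congr_deriv_Icc fun s hs => ?_⟩, by rwa [hY0], hYa⟩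
  simp only [Function.update_of_ne hs.1.ne', liouville]
  ring

/-- A solution behaving like `x ^ (l + 1)` at `0` is turned into one with unit slope at `0`. -/
theorem IsLiouvilleWeight.derivWithin_update_liouville_principal (h : IsLiouvilleWeight θ₀)
    (hl : -1 / 2 ≤ l) (hlead : Tendsto (fun x => θ₀ x / singularFactor l x) (𝓝[>] 0) (𝓝 1))
    {g : ℝ → ℂ} (hg : HasLeadingFactor (fun x => x ^ (l + 1)) g)
    (hd : DifferentiableOn ℝ (Function.update (liouville θ₀ g) 0 0) (Icc 0 (stringLength θ₀))) :
    derivWithin (Function.update (liouville θ₀ g) 0 0) (Icc 0 (stringLength θ₀)) 0 = 1 := by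
  have ha := h.stringLength_pos
  have hs := hasDerivWithinAt_iff_tendsto_slope.1 (hd 0 (left_mem_Icc.2 ha.le)).hasDerivWithinAt
  have hle : 𝓝[>] (0 : ℝ) ≤ 𝓝[Icc 0 (stringLength θ₀) \ {0}] 0 := by
    rw [← nhdsWithin_Ioc_eq_nhdsGT ha]
    exact nhdsWithin_mono _ fun s hs => ⟨Ioc_subset_Icc_self hs, hs.1.ne'⟩
  refine tendsto_nhds_unique ((hs.mono_left hle).comp h.tendsto_xi)
    ((h.tendsto_principal_div_xi hl hlead hg).congr' ?_)
  filter_upwards [Ioc_mem_nhdsGT (zero_lt_one' ℝ)] with x hx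
  have hxi := (h.xi_mem_Ioc hx).1.ne'
  rw [Function.comp_apply, slope_def_module, Function.update_of_ne hxi, Function.update_self,
    h.liouville_xi g (Ioc_subset_Icc_self hx), sub_zero, sub_zero, Complex.real_smul,
    Complex.ofReal_inv, div_eq_inv_mul _ (xi θ₀ x : ℂ)]

end UnitaryEquivalence

end PerturbedBessel

open PerturbedBessel in
theorem mainTheorem9
    (l : ℝ) (hl : -1 / 2 ≤ l) (hl' : l < 1 / 2)
    (q : ℝ → ℝ) (hq : PerturbedBessel.IsAdmissiblePotential l q)
    (φ θ : ℂ → ℝ → ℂ) (hsys : PerturbedBessel.IsBesselSystem l q φ θ)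
    (lam : ℝ)
    (hW : ∀ z : ℂ, Filter.Tendsto (PerturbedBessel.wronskian (θ lam) (θ z))
      (nhdsWithin 0 (Set.Ioi 0)) (nhds 0))
    (β : ℝ) (hβ : β ∈ Set.Ico 0 Real.pi)
    (ε : ℝ) (hε : 0 < ε)
    (hH : PerturbedBessel.BoundedBelowBy (PerturbedBessel.besselOp l q (θ lam) β) ε)
    (θ₀ : ℝ → ℝ) (hθ₀ : ∀ x ∈ Set.Ioc (0 : ℝ) 1, θ 0 x = (θ₀ x : ℂ))
    (a : ℝ) (ha : a = PerturbedBessel.stringLength θ₀)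
    (r : ℝ → ℝ) (hr : r = PerturbedBessel.stringWeight θ₀)
    (β' : ℝ) (hβ' : β' ∈ Set.Ico 0 Real.pi) (hββ' : PerturbedBessel.AnglesRelated θ₀ β β') :
    -- the transform is well defined
    (∀ x ∈ Set.Ioc (0 : ℝ) 1, 0 < θ₀ x) ∧
    MeasureTheory.IntegrableOn (fun x => 1 / θ₀ x ^ 2) (Set.Ioo 0 1) ∧
    Set.BijOn (PerturbedBessel.xi θ₀) (Set.Icc 0 1) (Set.Icc 0 a) ∧
    (∀ s ∈ Set.Ioo 0 a, 0 < r s) ∧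
    MeasureTheory.IntegrableOn r (Set.Ioo 0 a) ∧
    -- `U` is unitary and `H = U⁻¹ L U`
    (∃ U : PerturbedBessel.L2 ≃ₗᵢ[ℂ] PerturbedBessel.L2r a r,
      (∀ v : PerturbedBessel.L2,
        (U v : ℝ → ℂ) =ᵐ[PerturbedBessel.stringMeasure a r] PerturbedBessel.liouville θ₀ v) ∧
      ∀ f h : PerturbedBessel.L2,
        (f, h) ∈ (PerturbedBessel.besselOp l q (θ lam) β).graph ↔
          (U f, U h) ∈ (PerturbedBessel.stringOp a r β').graph) ∧
    -- the fundamental solutions: `c(z) = U θ(z)` and `s(z) = U φ(z)`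
    (∃ c s : ℂ → ℝ → ℂ, PerturbedBessel.IsStringSystem a r c s) ∧
    (∀ c s : ℂ → ℝ → ℂ, PerturbedBessel.IsStringSystem a r c s →
      (∀ z : ℂ, ∀ ξ ∈ Set.Ioc 0 a,
        c z ξ = PerturbedBessel.liouville θ₀ (θ z) ξ ∧
        s z ξ = PerturbedBessel.liouville θ₀ (φ z) ξ) ∧
      -- the `m`-functions exist and coincide
      (∃ m : ℂ → ℂ, PerturbedBessel.IsBesselWeylFunction φ θ β m) ∧
      (∃ M : ℂ → ℂ, PerturbedBessel.IsStringWeylFunction a c s β' M) ∧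
      ∀ m M : ℂ → ℂ, PerturbedBessel.IsBesselWeylFunction φ θ β m →
        PerturbedBessel.IsStringWeylFunction a c s β' M →
          ∀ z : ℂ, z.im ≠ 0 → m z = M z) := by
  have h01 : Ioo (0 : ℝ) 1 ∈ 𝓝[>] (0 : ℝ) := Ioo_mem_nhdsGT zero_lt_one
  have hp := fun x hx => singularFactor_pos hl (x := x) hx
  -- `θ₀` is a solution of energy zero with the leading behaviour `singularFactor l`.
  have hsol0 := hsys.solves_theta 0
  have hEq : EqOn (fun x => (θ₀ x : ℂ)) (θ 0) (Ioc 0 1) := fun x hx => (hθ₀ x hx).symm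
  have hu : HasSecondDeriv (Ioc 0 1) (fun x => (θ₀ x : ℂ))
      (fun x => (besselPotential l q x : ℂ) * θ₀ x) :=
    (HasSecondDeriv.congr hsol0 hEq).congr_deriv ordConnected_Ioc fun x hx => by
      simp only [hθ₀ x hx, sub_zero]
  have hWeq : ∀ t : ℝ → ℂ, ∀ x ∈ Ioc (0 : ℝ) 1,
      wronskian (fun x => (θ₀ x : ℂ)) t x = wronskian (θ 0) t x := fun t x hx => by
    simp only [wronskian, derivWithin_congr hEq (hEq hx), hθ₀ x hx]
  have hlead : Tendsto (fun x => θ₀ x / singularFactor l x) (𝓝[>] 0) (𝓝 1) := by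
    have := (Complex.continuous_re.tendsto 1).comp ((hsys.leading_theta 0).tendsto_div hp)
    rw [Complex.one_re] at this
    refine this.congr' ?_
    filter_upwards [h01] with x hx
    rw [Function.comp_apply, hθ₀ x (Ioo_subset_Ioc_self hx), ← Complex.ofReal_div,
      Complex.ofReal_re]
  have hcont : ContinuousOn θ₀ (Ioc 0 1) := fun x hx =>
    (hasDerivWithinAt_of_ofReal (hu.1 x hx)).continuousWithinAt
  have h2 := integrableOn_sq_of_leading hl hl' hcont hlead
  have hposnear : ∀ᶠ x in 𝓝[>] 0, 0 < θ₀ x :=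
    (eventually_ratio_bounds hl hlead).mono fun x hx => by linarith [hx.1, hx.2.1]
  have hWt : Tendsto (wronskian (fun x => (θ₀ x : ℂ)) (θ lam)) (𝓝[>] 0) (𝓝 0) := by
    have := (hW 0).neg
    rw [neg_zero] at this
    refine this.congr' ?_
    filter_upwards [Ioc_mem_nhdsGT (zero_lt_one' ℝ)] with x hx
    rw [hWeq _ x hx]
    simp only [wronskian]
    ring
  have hpos : ∀ x ∈ Ioc (0 : ℝ) 1, 0 < θ₀ x := fun x hx => pos_of_ne_zero hcont
    (fun y hy => hH.ne_zero hε hu hWt h2 hposnear hy) hposnear hx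
  have h : IsLiouvilleWeight θ₀ := isLiouvilleWeight_of_leading hl hpos hcont hlead
  have hst := h.stringLength_pos
  subst ha hr
  -- The limits of `θ(z) / θ₀` and `φ(z) / θ₀` at `0`.
  have hθlim : ∀ z, Tendsto (fun x => θ z x / θ₀ x) (𝓝[>] 0) (𝓝 1) := fun z => by
    have := ((hsys.leading_theta z).tendsto_div hp).div
      ((Complex.continuous_ofReal.tendsto 1).comp hlead) (by simp)
    rw [Complex.ofReal_one, div_one] at this
    refine this.congr' ?_
    filter_upwards [h01] with x hx
    have := Complex.ofReal_ne_zero.2 (hp x hx).ne'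
    simp only [Function.comp_apply, Complex.ofReal_div, Pi.div_apply]
    exact div_div_div_cancel_right₀ this _ _
  have hφlim : ∀ z, Tendsto (fun x => φ z x / θ₀ x) (𝓝[>] 0) (𝓝 0) := fun z => by
    have h1 := h.tendsto_principal_div_xi hl hlead (hsys.leading_phi z)
    have h3 := (Complex.continuous_ofReal.tendsto 0).comp
      (h.tendsto_xi.mono_right nhdsWithin_le_nhds)
    have := h1.mul h3
    rw [Complex.ofReal_zero, mul_zero] at this
    refine this.congr' ?_
    filter_upwards [Ioc_mem_nhdsGT (zero_lt_one' ℝ)] with x hx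
    exact div_mul_cancel₀ _ (Complex.ofReal_ne_zero.2 (h.xi_mem_Ioc hx).1.ne')
  -- The fundamental solutions of the string.
  set c₀ : ℂ → ℝ → ℂ := fun z => Function.update (liouville θ₀ (θ z)) 0 1 with hc₀
  set s₀ : ℂ → ℝ → ℂ := fun z => Function.update (liouville θ₀ (φ z)) 0 0 with hs₀
  have hc := fun z => h.hasSecondDeriv_update_liouville hu h2 (hsys.solves_theta z) (hθlim z)
  have hs := fun z => h.hasSecondDeriv_update_liouville hu h2 (hsys.solves_phi z) (hφlim z)
  have hsystem : IsStringSystem (stringLength θ₀) (stringWeight θ₀) c₀ s₀ := by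
    refine ⟨fun z => (hc z).1, fun z => (hs z).1, fun z => Function.update_self _ _ _, fun z => ?_,
      fun z => Function.update_self _ _ _, fun z => ?_⟩
    · have := tendsto_nhds_unique (h.tendsto_wronskian (hθlim lam) hWt (hθlim z) (hc z).2.1)
        ((hW z).neg.congr fun x => by simp only [wronskian]; ring)
      rw [neg_zero] at this
      exact neg_eq_zero.1 this
    · exact h.derivWithin_update_liouville_principal hl hlead (hsys.leading_phi z) (hs z).1.1
  obtain ⟨U, hU⟩ := h.exists_unitary
  refine ⟨hpos, h.integrableOn, h.xi_bijOn, fun s hs => h.stringWeight_pos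
    (Ioo_subset_Ioc_self hs), h.integrableOn_stringWeight (h2.mono_set Ioo_subset_Ioc_self),
    ⟨U, hU, fun f k => h.mem_graph_iff hu h2 (hθlim lam) hWt hβ hβ' hββ' (hU f) (hU k)⟩,
    ⟨c₀, s₀, hsystem⟩, ?_⟩
  intro c s hcs
  have hceq : ∀ z, EqOn (c z) (c₀ z) (Icc 0 (stringLength θ₀)) := fun z ξ hξ => by
    have := string_solution_eq hst.le (hcs.solves_c z) (hcs.solves_s z) (hsystem.solves_c z)
      (hcs.c_zero z) (hcs.c_deriv_zero z) (hcs.s_zero z) (hcs.s_deriv_zero z) hξ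
    rw [hsystem.c_zero z, hsystem.c_deriv_zero z] at this
    rw [this]; ring
  have hseq : ∀ z, EqOn (s z) (s₀ z) (Icc 0 (stringLength θ₀)) := fun z ξ hξ => by
    have := string_solution_eq hst.le (hcs.solves_c z) (hcs.solves_s z) (hsystem.solves_s z)
      (hcs.c_zero z) (hcs.c_deriv_zero z) (hcs.s_zero z) (hcs.s_deriv_zero z) hξ
    rw [hsystem.s_zero z, hsystem.s_deriv_zero z] at this
    rw [this]; ring
  -- The boundary forms of corresponding solutions at the right endpoints are proportional.
  obtain ⟨κ, hκ, hBC⟩ := h.exists_boundary_factor hu.1 hβ hβ' hββ'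
  have hend := right_mem_Icc.2 hst.le
  set Bθ : ℂ → ℂ := fun z =>
    Real.cos β * θ z 1 - Real.sin β * derivWithin (θ z) (Ioc 0 1) 1 with hBθ
  set Bφ : ℂ → ℂ := fun z =>
    Real.cos β * φ z 1 - Real.sin β * derivWithin (φ z) (Ioc 0 1) 1 with hBφ
  have hBc : ∀ z, Real.cos β' * c z (stringLength θ₀) - Real.sin β' *
      derivWithin (c z) (Icc 0 (stringLength θ₀)) (stringLength θ₀) = κ * Bθ z := fun z => by
    rw [derivWithin_congr (hceq z) (hceq z hend), hceq z hend, (hc z).2.2, hBθ, ← hBC]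
    simp only [hc₀, Function.update_of_ne hst.ne', liouville, h.xiInv_stringLength]
  have hBs : ∀ z, Real.cos β' * s z (stringLength θ₀) - Real.sin β' *
      derivWithin (s z) (Icc 0 (stringLength θ₀)) (stringLength θ₀) = κ * Bφ z := fun z => by
    rw [derivWithin_congr (hseq z) (hseq z hend), hseq z hend, (hs z).2.2, hBφ, ← hBC]
    simp only [hs₀, Function.update_of_ne hst.ne', liouville, h.xiInv_stringLength]
  have hne : ∀ z : ℂ, z.im ≠ 0 → Bθ z ≠ 0 := fun z hz h0 =>
    hz (im_eq_zero_of_BCString hst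
      (fun ξ hξ => h.stringWeight_pos (Ioo_subset_Ioc_self hξ)) (hcs.solves_c z) (hcs.c_zero z)
      (hcs.c_deriv_zero z) (β := β') (by rw [BCString, hBc, h0, mul_zero]))
  have hm : ∀ z m, BCOne β (fun x => φ z x - m * θ z x) ↔ Bφ z = m * Bθ z := fun z m =>
    BCOne_sub_mul_iff (hsys.solves_phi z).1 (hsys.solves_theta z).1 m
  have hM : ∀ z m, BCString (stringLength θ₀) β' (fun ξ => s z ξ - m * c z ξ) ↔
      Bφ z = m * Bθ z := fun z m => by
    rw [BCString_sub_mul_iff hst (hcs.solves_s z).1 (hcs.solves_c z).1, hBc, hBs,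
      mul_left_comm m κ, mul_right_inj' hκ]
  refine ⟨fun z ξ hξ => ⟨?_, ?_⟩, ⟨fun z => Bφ z / Bθ z, fun z hz => ?_⟩,
    ⟨fun z => Bφ z / Bθ z, fun z hz => ?_⟩, fun m M hm' hM' z hz => ?_⟩
  · rw [hceq z (Ioc_subset_Icc_self hξ)]
    exact Function.update_of_ne hξ.1.ne' _ _
  · rw [hseq z (Ioc_subset_Icc_self hξ)]
    exact Function.update_of_ne hξ.1.ne' _ _
  · exact (hm z _).2 (div_mul_cancel₀ _ (hne z hz)).symm
  · exact (hM z _).2 (div_mul_cancel₀ _ (hne z hz)).symm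
  · exact mul_right_cancel₀ (hne z hz) (((hm z _).1 (hm' z hz)).symm.trans ((hM z _).1 (hM' z hz)))
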